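/- All languages are countable and all theories are complete first-order theories. For a complete theory $T$ let $I(T,\omega)$ be the number of (at most) countable models of $T$ up to isomorphism; if $T$ has infinite models, this is the number of its models of cardinality $\omega$. Let ${\rm LRK}(T)$ be the set of isomorphism types of countable models of $T$ that are prime over some finite set of their elements, with the Rudin--Keisler preorder: the type of $\mathcal M$ is below the type of $\mathcal N$ if and only if $\mathcal M$ is isomorphic to an elementary submodel of $\mathcal N$. Distinct isomorphism types are not identified, even if each is below the other. We say that ${\rm LRK}(T)$ is a lattice, a Boolean lattice, or linearly ordered if its preorder is a partial order that is, respectively, a lattice order, the order of a Boolean algebra (possibly with one element), or a linear order. The disjoint union of structures $\mathcal M_1$, $\mathcal M_2$ in disjoint languages $\Sigma_1$, $\Sigma_2$ is the structure with universe the disjoint union of $M_1$ and $M_2$, in which the symbols of $\Sigma_i$ are interpreted on $M_i$ as in $\mathcal M_i$ (function symbols and constants being represented by relation symbols for their graphs), together with two unary predicates that name $M_1$ and $M_2$. A disjoint union of complete theories $T_1$, $T_2$ in disjoint languages is the complete theory of the disjoint union of a model of $T_1$ and a model of $T_2$. Theorem. Let $T$ be a disjoint union of complete theories $T_1$ and $T_2$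 in disjoint countable languages such that $I(T_1,\omega)$ and $I(T_2,\omega)$ are finite. Then: (1) ${\rm LRK}(T)$ is a lattice if and only if ${\rm LRK}(T_1)$ and ${\rm LRK}(T_2)$ are both lattices; and ${\rm LRK}(T)$ is a Boolean lattice if and only if ${\rm LRK}(T_1)$ and ${\rm LRK}(T_2)$ are both Boolean lattices; (2) ${\rm LRK}(T)$ is linearly ordered if and only if ${\rm LRK}(T_1)$ and ${\rm LRK}(T_2)$ are both linearly ordered and $\min\{I(T_1,\omega),I(T_2,\omega)\}=1$. -/

import Mathlib

open FirstOrder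

universe u v u₁ v₁ u₂ v₂ w₁ w₂

namespace FirstOrder.Language

section DisjointUnion

/-- Relation symbols of the language of disjoint unions: the relation symbols of both languages,
a symbol for the graph of each function symbol (or constant) of both languages, and two unary
predicates naming the two parts. -/
inductive DisjointRel (L₁ : Language.{u₁, v₁}) (L₂ : Language.{u₂, v₂}) :
    ℕ → Type (max u₁ v₁ u₂ v₂)
  | relLeft {n : ℕ} (R : L₁.Relations n) : DisjointRel L₁ L₂ n
  | relRight {n : ℕ} (R : L₂.Relations n) : DisjointRel L₁ L₂ n
  | graphLeft {n : ℕ} (f : L₁.Functions n) : DisjointRel L₁ L₂ (n + 1)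
  | graphRight {n : ℕ} (f : L₂.Functions n) : DisjointRel L₁ L₂ (n + 1)
  | partLeft : DisjointRel L₁ L₂ 1
  | partRight : DisjointRel L₁ L₂ 1

/-- The (relational) language of disjoint unions of an `L₁`-structure and an `L₂`-structure. The
symbols of `L₁` and `L₂` are made disjoint by construction. A function symbol is represented by the
symbol for its graph, because its interpretation is a partial operation on the union. -/
def disjointLanguage (L₁ : Language.{u₁, v₁}) (L₂ : Language.{u₂, v₂}) :
    Language.{0, max u₁ v₁ u₂ v₂} where
  Functions := fun _ => Empty
  Relations := DisjointRel L₁ L₂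

/-- The disjoint union of an `L₁`-structure `M` and an `L₂`-structure `N`: the universe is `M ⊕ N`,
the symbols of `L₁` live on `M`, those of `L₂` on `N`, and the two unary predicates name `M`
and `N`. -/
instance disjointUnionStructure (L₁ : Language.{u₁, v₁}) (L₂ : Language.{u₂, v₂})
    (M : Type w₁) (N : Type w₂) [L₁.Structure M] [L₂.Structure N] :
    (disjointLanguage L₁ L₂).Structure (M ⊕ N) where
  funMap := fun f _ => Empty.elim f
  RelMap := fun {_} r x =>
    match r, x with
    | .relLeft (n := n) R, x =>
        ∃ a : Fin n → M, (∀ i, x i = Sum.inl (a i)) ∧ Structure.RelMap R a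
    | .relRight (n := n) R, x =>
        ∃ a : Fin n → N, (∀ i, x i = Sum.inr (a i)) ∧ Structure.RelMap R a
    | .graphLeft (n := n) f, x =>
        ∃ a : Fin n → M, (∀ i : Fin n, x i.castSucc = Sum.inl (a i)) ∧
          x (Fin.last n) = Sum.inl (Structure.funMap f a)
    | .graphRight (n := n) f, x =>
        ∃ a : Fin n → N, (∀ i : Fin n, x i.castSucc = Sum.inr (a i)) ∧
          x (Fin.last n) = Sum.inr (Structure.funMap f a)
    | .partLeft, x => ∃ a : M, x 0 = Sum.inl a
    | .partRight, x => ∃ b : N, x 0 = Sum.inr b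

/-- `T` is the disjoint union of the theories `T₁` and `T₂`: it is the complete theory of the
disjoint union of a model of `T₁` and a model of `T₂`. -/
def IsDisjointUnion {L₁ : Language.{u₁, v₁}} {L₂ : Language.{u₂, v₂}}
    (T : (disjointLanguage L₁ L₂).Theory) (T₁ : L₁.Theory) (T₂ : L₂.Theory) : Prop :=
  ∃ (M₁ : Theory.ModelType.{u₁, v₁, w₁} T₁) (M₂ : Theory.ModelType.{u₂, v₂, w₂} T₂),
    T = (disjointLanguage L₁ L₂).completeTheory (M₁ ⊕ M₂)

end DisjointUnion

section CountableModels

variable {L : Language.{u, v}}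

/-- `M` is a prime model over some finite tuple `a` of its elements: whenever a tuple `b` of a
structure `N` has the same type as `a`, some elementary embedding of `M` in `N` maps `a` to `b`. -/
def IsPrimeOverFinite (L : Language.{u, v}) (M : Type) [L.Structure M] : Prop :=
  ∃ (n : ℕ) (a : Fin n → M), ∀ (N : Type) [L.Structure N] (b : Fin n → N),
    (∀ φ : L.Formula (Fin n), φ.Realize a ↔ φ.Realize b) →
      ∃ f : M ↪ₑ[L] N, ∀ i, f (a i) = b i

/-- The (at most) countable models of `T`. Every such model has a copy with universe in `Type`. -/
def CountableModel (T : L.Theory) : Type (max u v 1) :=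
  {M : Theory.ModelType.{u, v, 0} T // Countable M}

/-- Isomorphism of countable models. -/
instance countableModelSetoid (T : L.Theory) : Setoid (CountableModel T) where
  r M N := Nonempty (M.1 ≃[L] N.1)
  iseqv :=
    { refl := fun _ => ⟨Language.Equiv.refl L _⟩
      symm := fun ⟨e⟩ => ⟨e.symm⟩
      trans := fun ⟨e⟩ ⟨f⟩ => ⟨f.comp e⟩ }

/-- The isomorphism types of countable models of `T`. -/
def CountableIsoType (T : L.Theory) : Type (max u v 1) :=
  Quotient (countableModelSetoid T)

/-- The number `I(T, ω)` of countable models of `T` up to isomorphism. -/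
noncomputable def numCountableModels (T : L.Theory) : ℕ∞ :=
  ENat.card (CountableIsoType T)

/-- The set of isomorphism types of countable models of `T` that are prime over a finite set. -/
def LRK (T : L.Theory) : Type (max u v 1) :=
  {c : CountableIsoType T //
    ∃ M : CountableModel T, Quotient.mk (countableModelSetoid T) M = c ∧ IsPrimeOverFinite L M.1}

/-- The Rudin-Keisler preorder: the type of `M` is below the type of `N` if `M` is isomorphic to an
elementary submodel of `N`. -/
instance LRK.instPreorder (T : L.Theory) : Preorder (LRK T) where
  le c d := ∃ M N : CountableModel T, Quotient.mk (countableModelSetoid T) M = c.1 ∧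
    Quotient.mk (countableModelSetoid T) N = d.1 ∧ Nonempty (M.1 ↪ₑ[L] N.1)
  le_refl c := by
    obtain ⟨M, hM, -⟩ := c.2
    exact ⟨M, M, hM, hM, ⟨ElementaryEmbedding.refl L M.1⟩⟩
  le_trans c d e := by
    rintro ⟨M, N, hM, hN, ⟨f⟩⟩ ⟨N', K, hN', hK, ⟨g⟩⟩
    obtain ⟨i⟩ : Nonempty (N.1 ≃[L] N'.1) := Quotient.exact (hN.trans hN'.symm)
    exact ⟨M, K, hM, hK, ⟨g.comp (i.toElementaryEmbedding.comp f)⟩⟩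

end CountableModels

section Orders

/-- A preordered set is a lattice. In particular the preorder is antisymmetric. -/
def IsLatticeOrdered (α : Type*) [p : Preorder α] : Prop :=
  ∃ l : Lattice α, ∀ a b : α, l.le a b ↔ p.le a b

/-- A preordered set is a Boolean lattice. In particular the preorder is antisymmetric. -/
def IsBooleanOrdered (α : Type*) [p : Preorder α] : Prop :=
  ∃ l : BooleanAlgebra α, ∀ a b : α, l.le a b ↔ p.le a b

/-- A preordered set is linearly ordered. In particular the preorder is antisymmetric. -/
def IsLinearlyOrdered (α : Type*) [p : Preorder α] : Prop :=
  ∃ l : LinearOrder α, ∀ a b : α, l.le a b ↔ p.le a b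

end Orders

end FirstOrder.Language

/-!
The preorder `LRK T` of a disjoint union `T` of complete theories `T₁` and `T₂` is isomorphic to the
product `LRK T₁ × LRK T₂` (`nonempty_LRK_orderIso_prod`). Three facts about disjoint unions give
this.

* The type of a tuple of `M ⊕ N` is determined by the types of its two parts (`SameType.sumMap`):
  every formula defines in `M ⊕ N` a finite union of rectangles, each given by a formula about the
  left side and a formula about the right side, uniformly in `M` and `N` (`realize_rects`). Hence
  sums of elementary embeddings are elementary.
* Conversely, formulas about `M` or about `N` translate to formulas about `M ⊕ N` by relativizing
  quantifiers and unnesting terms (`IsPart.realize_translate`). Hence elementary embeddings of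
  disjoint unions restrict to the two sides, and every model of `T` is the disjoint union of a model
  of `T₁` and a model of `T₂` (`exists_sum_equiv`).
* It follows that a disjoint union is prime over a finite tuple if and only if both sides are prime
  over the corresponding parts of this tuple (`IsPrimeOverFinite.sum`, `IsPrimeOverFinite.of_sum`).

A product of two nonempty preorders is a lattice, or a Boolean lattice, if and only if both factors
are, and it is a linear order if and only if both factors are and one of them has a single element.
That the finiteness of `I(Tᵢ, ω)` implies that `LRK Tᵢ` is nonempty, and that `LRK Tᵢ` has a single
element if and only if `I(Tᵢ, ω) = 1` (`numCountableModels_eq_one_iff`), comes from the theory of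
atomic models: with only countably many countable models, isolated types are dense
(`exists_isolatedOver`), so each finite tuple of a model lies in a countable elementary submodel
that is atomic over it (`exists_atomicOver`). Countable atomic models are prime and unique by the
usual back-and-forth argument. If `LRK Tᵢ` has a single element, then the atomic model realizes all
types over the empty set, so all countable models are atomic and therefore isomorphic.
-/

namespace FirstOrder.Language

/-! ### Tuples with the same type -/

section SameType

variable {L : Language.{u, v}} {M N P : Type*} [L.Structure M] [L.Structure N] [L.Structure P]
  {α β γ ι : Type*}

/-- The tuples `a` and `b`, possibly in different structures, have the same complete type. -/
def SameType (L : Language.{u, v}) {M N : Type*} [L.Structure M] [L.Structure N] {α : Type*}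
    (a : α → M) (b : α → N) : Prop :=
  ∀ φ : L.Formula α, φ.Realize a ↔ φ.Realize b

theorem SameType.symm {a : α → M} {b : α → N} (h : SameType L a b) : SameType L b a :=
  fun φ => (h φ).symm

theorem SameType.trans {a : α → M} {b : α → N} {c : α → P} (h : SameType L a b)
    (h' : SameType L b c) : SameType L a c :=
  fun φ => (h φ).trans (h' φ)

theorem SameType.comp {a : α → M} {b : α → N} (h : SameType L a b) (k : β → α) :
    SameType L (a ∘ k) (b ∘ k) := fun φ => by
  simpa only [Formula.realize_relabel] using h (φ.relabel k)

theorem ElementaryEmbedding.sameType (f : M ↪ₑ[L] N) (a : α → M) : SameType L a (f ∘ a) :=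
  fun φ => (f.map_formula φ a).symm

theorem Equiv.sameType (f : M ≃[L] N) (a : α → M) : SameType L a (f ∘ a) :=
  f.toElementaryEmbedding.sameType a

theorem SameType.elementarilyEquivalent {a : α → M} {b : α → N} (h : SameType L a b) :
    M ≅[L] N := by
  rw [elementarilyEquivalent_iff]
  intro φ
  have := h (φ.relabel Empty.elim)
  rw [Formula.realize_relabel, Formula.realize_relabel] at this
  unfold Sentence.Realize
  convert this

theorem ElementarilyEquivalent.sameType [IsEmpty α] (h : M ≅[L] N) (a : α → M) (b : α → N) :
    SameType L a b := fun φ => by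
  have := elementarilyEquivalent_iff.1 h (φ.relabel isEmptyElim)
  unfold Sentence.Realize at this
  rw [Formula.realize_relabel, Formula.realize_relabel] at this
  convert this

theorem SameType.forall_realize [Finite β] {a : α → M} {b : α → N} (h : SameType L a b)
    (φ : L.Formula (α ⊕ β)) :
    (∀ v, φ.Realize (Sum.elim a v)) ↔ ∀ v, φ.Realize (Sum.elim b v) := by
  simpa only [Formula.realize_iAlls] using h (φ.iAlls β)

theorem SameType.exists_realize [Finite β] {a : α → M} {b : α → N} (h : SameType L a b)
    (φ : L.Formula (α ⊕ β)) :
    (∃ v, φ.Realize (Sum.elim a v)) ↔ ∃ v, φ.Realize (Sum.elim b v) := by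
  simpa only [Formula.realize_iExs] using h (φ.iExs β)

theorem ElementarilyEquivalent.forall_realize [Finite β] (h : M ≅[L] N) (φ : L.Formula β) :
    (∀ v : β → M, φ.Realize v) ↔ ∀ v : β → N, φ.Realize v := by
  have := (h.sameType (Empty.elim : Empty → M) (Empty.elim : Empty → N)).forall_realize
    (φ.relabel Sum.inr)
  simpa only [Formula.realize_relabel, Sum.elim_comp_inr] using this

end SameType

/-! ### Elementary substructures and countable models -/

section ElementarySubstructures

variable {L : Language.{u, v}} {M N : Type*} [L.Structure M] [L.Structure N]

/-- The Tarski–Vaught test, for a subset. -/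
theorem exists_elementarySubstructure_of_test (S : Set M)
    (hS : ∀ (n : ℕ) (φ : L.Formula (Fin (n + 1))) (x : Fin n → M), (∀ i, x i ∈ S) →
      (∃ y, φ.Realize (Fin.snoc x y : Fin (n + 1) → M)) →
        ∃ y ∈ S, φ.Realize (Fin.snoc x y : Fin (n + 1) → M)) :
    ∃ E : L.ElementarySubstructure M, (E : Set M) = S := by
  let E : L.Substructure M :=
    { carrier := S
      fun_mem := by
        intro n f x hx
        obtain ⟨y, hy, h⟩ := hS n (Term.equal (func f fun i => Term.var i.castSucc)
          (Term.var (Fin.last n))) x hx ⟨Structure.funMap f x, by simp [Formula.realize_equal]⟩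
        simp [Formula.realize_equal] at h
        exact h ▸ hy }
  refine ⟨E.toElementarySubstructure ?_, rfl⟩
  intro n φ x a h
  obtain ⟨y, hy, h'⟩ := hS n (φ.toFormula.relabel (Sum.elim Empty.elim id)) (fun i => x i)
    (fun i => (x i).2) ⟨a, by
      rw [Formula.realize_relabel, BoundedFormula.realize_toFormula]
      convert h
      rfl⟩
  refine ⟨⟨y, hy⟩, ?_⟩
  rw [Formula.realize_relabel, BoundedFormula.realize_toFormula] at h'
  convert h'
  rfl

open Cardinal in
theorem exists_countable_elementarySubstructure {M : Type w₁} [L.Structure M]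
    [Countable L.Symbols] (s : Set M) (hs : s.Countable) :
    ∃ E : L.ElementarySubstructure M, s ⊆ E ∧ Countable E := by
  by_cases hM : Countable M
  · exact ⟨⊤, fun _ _ => trivial, inferInstanceAs (Countable (⊤ : Set M))⟩
  · obtain ⟨E, hE, hc⟩ := exists_elementarySubstructure_card_eq L s (ℵ₀ : Cardinal.{0}) le_rfl
      (by simpa using hs) (by
        have : L.card ≤ ℵ₀ := mk_le_aleph0_iff.2 ‹_›
        simpa using this) (by
        rw [← mk_le_aleph0_iff, not_le] at hM
        simpa using hM.le)
    refine ⟨E, hE, ?_⟩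
    rw [← mk_le_aleph0_iff]
    simpa using hc.le

/-- A countable structure has an isomorphic copy with universe in `Type`. -/
theorem exists_equiv_type_zero (M : Type w₁) [L.Structure M] [Countable M] :
    ∃ (N : Type) (_ : L.Structure N), Nonempty (M ≃[L] N) := by
  obtain ⟨N, ⟨e⟩⟩ := (Countable.toSmall.{0} M).equiv_small
  exact ⟨N, e.inducedStructure, ⟨e.inducedStructureEquiv⟩⟩

end ElementarySubstructures

/-- Dependent choice: a sequence can be built element by element, keeping an invariant `P` of the
initial segments and meeting at each stage the requirement `D`. -/
theorem exists_seq_of_extend {X : Type*} (P : ∀ n, (Fin n → X) → Prop)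
    (D : ∀ n, (Fin n → X) → X → Prop) (h0 : ∀ t, P 0 t)
    (h : ∀ n t, P n t → ∃ x, P (n + 1) (Fin.snoc t x : Fin (n + 1) → X) ∧ D n t x) :
    ∃ g : ℕ → X, ∀ n, P n (fun i => g i) ∧ D n (fun i => g i) (g n) := by
  have : Nonempty X := (h 0 Fin.elim0 (h0 _)).nonempty
  choose! F hF using h
  let T : ∀ n, Fin n → X := fun n =>
    Nat.rec (motive := fun n => Fin n → X) Fin.elim0 (fun n t => Fin.snoc t (F n t)) n
  have hT : ∀ n, T (n + 1) = Fin.snoc (T n) (F n (T n)) := fun n => rfl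
  have hP : ∀ n, P n (T n) := fun n => by
    induction n with
    | zero => exact h0 _
    | succ n ih => rw [hT]; exact (hF n _ ih).1
  have hg : ∀ n (i : Fin n), T n i = F i (T i) := fun n => by
    induction n with
    | zero => exact fun i => i.elim0
    | succ n ih =>
      intro i
      rw [hT]
      refine Fin.lastCases ?_ (fun j => ?_) i
      · simp
      · simpa using ih j
  refine ⟨fun n => F n (T n), fun n => ?_⟩
  have : (fun i : Fin n => F i (T i)) = T n := (funext (hg n)).symm
  rw [this]
  exact ⟨hP n, (hF n _ (hP n)).2⟩

/-! ### Isolated types and atomic models -/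

section Isolated

variable {L : Language.{u, v}} {M N : Type*} [L.Structure M] [L.Structure N] {ι β γ : Type*}

/-- The type of the tuple `b` over the tuple `a` is isolated by a formula. -/
def IsolatedOver (L : Language.{u, v}) {M : Type*} [L.Structure M] {ι β : Type*} (a : ι → M)
    (b : β → M) : Prop :=
  ∃ χ : L.Formula (ι ⊕ β), χ.Realize (Sum.elim a b) ∧
    ∀ c : β → M, χ.Realize (Sum.elim a c) → SameType L (Sum.elim a b) (Sum.elim a c)

/-- The structure is atomic over the tuple `a`: all types of finite tuples over `a` are isolated. -/
def AtomicOver (L : Language.{u, v}) {M : Type*} [L.Structure M] {ι : Type*} (a : ι → M) : Prop :=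
  ∀ (n : ℕ) (b : Fin n → M), IsolatedOver L a b

theorem SameType.of_imp {a : β → M} {b : β → N} (h : ∀ φ : L.Formula β, φ.Realize a → φ.Realize b) :
    SameType L a b := fun φ => by
  refine ⟨h φ, fun hb => ?_⟩
  by_contra ha
  exact h φ.not ha hb

theorem SameType.of_sumElim {a : ι → M} {b : β → M} {a' : ι → N} {b' : β → N}
    (h : SameType L (Sum.elim a b) (Sum.elim a' b')) : SameType L a a' := by
  simpa using h.comp Sum.inl

/-- A formula isolating the type of `b` over `a` isolates a type over any tuple of the same type
as `a`. -/
theorem SameType.of_isolating [Finite β] {a : ι → M} {b : β → M} {a' : ι → N} {b' : β → N}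
    (h : SameType L a a') {χ : L.Formula (ι ⊕ β)}
    (hχ : ∀ c : β → M, χ.Realize (Sum.elim a c) → SameType L (Sum.elim a b) (Sum.elim a c))
    (hb' : χ.Realize (Sum.elim a' b')) : SameType L (Sum.elim a b) (Sum.elim a' b') := by
  refine SameType.of_imp fun φ hφ => ?_
  have := (h.forall_realize (χ.imp φ)).1 fun c => by
    rw [Formula.realize_imp]
    exact fun hc => (hχ c hc φ).1 hφ
  exact Formula.realize_imp.1 (this b') hb'

theorem IsolatedOver.of_sameType [Finite β] {a : ι → M} {b : β → M} {a' : ι → N} {b' : β → N}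
    (hb : IsolatedOver L a b) (h : SameType L (Sum.elim a b) (Sum.elim a' b')) :
    IsolatedOver L a' b' := by
  obtain ⟨χ, h1, h2⟩ := hb
  exact ⟨χ, (h χ).1 h1, fun c hc => h.symm.trans (h.of_sumElim.of_isolating h2 hc)⟩

theorem IsolatedOver.comp [Finite β] [Finite γ] {a : ι → M} {b : β → M} (hb : IsolatedOver L a b)
    (k : γ → β) : IsolatedOver L a (b ∘ k) := by
  obtain ⟨χ, h1, h2⟩ := hb
  -- The isolating formula says of `z` that some `y` satisfies `χ` and `z = y ∘ k`.
  let θ : L.Formula ((ι ⊕ γ) ⊕ β) :=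
    χ.relabel (Sum.elim (Sum.inl ∘ Sum.inl) Sum.inr) ⊓
      Formula.iInf fun j : γ =>
        Term.equal (Term.var (Sum.inl (Sum.inr j))) (Term.var (Sum.inr (k j)))
  have hθ : ∀ c : γ → M, (θ.iExs β).Realize (Sum.elim a c) ↔
      ∃ y : β → M, χ.Realize (Sum.elim a y) ∧ c = y ∘ k := by
    intro c
    rw [Formula.realize_iExs]
    refine exists_congr fun y => ?_
    have : Sum.elim (Sum.elim a c) y ∘ Sum.elim (Sum.inl ∘ Sum.inl) Sum.inr = Sum.elim a y := by
      ext (i | i) <;> rfl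
    simp only [θ, Formula.realize_inf, Formula.realize_relabel, this, Formula.realize_iInf,
      Formula.realize_equal, funext_iff]
    rfl
  refine ⟨θ.iExs β, (hθ _).2 ⟨b, h1, rfl⟩, fun c hc => ?_⟩
  obtain ⟨y, hy, rfl⟩ := (hθ c).1 hc
  have := (h2 y hy).comp (Sum.map id k)
  simpa [Sum.elim_comp_map] using this

/-- The regrouping of the variables that singles out the last one. -/
def splitLast (ι : Type*) (n : ℕ) : ι ⊕ Fin (n + 1) → (ι ⊕ Fin n) ⊕ Unit :=
  Sum.elim (fun i => Sum.inl (Sum.inl i))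
    (Fin.snoc (α := fun _ => (ι ⊕ Fin n) ⊕ Unit) (fun j => Sum.inl (Sum.inr j)) (Sum.inr ()))

theorem elim_comp_splitLast {X : Type*} {n : ℕ} (a : ι → X) (t : Fin n → X) (y : Unit → X) :
    Sum.elim (Sum.elim a t) y ∘ splitLast ι n =
      Sum.elim a (Fin.snoc t (y ()) : Fin (n + 1) → X) := by
  ext (i | i)
  · rfl
  · refine Fin.lastCases ?_ (fun j => ?_) i <;> simp [splitLast]

/-- The extension step: a new element of isolated type has a counterpart over any tuple of the same
type. -/
theorem SameType.exists_snoc {n : ℕ} {a : ι → M} {t : Fin n → M} {a' : ι → N} {t' : Fin n → N}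
    (h : SameType L (Sum.elim a t) (Sum.elim a' t')) (m : M)
    (hm : IsolatedOver L a (Fin.snoc t m : Fin (n + 1) → M)) :
    ∃ m' : N, SameType L (Sum.elim a (Fin.snoc t m : Fin (n + 1) → M))
      (Sum.elim a' (Fin.snoc t' m' : Fin (n + 1) → N)) := by
  obtain ⟨χ, h1, h2⟩ := hm
  obtain ⟨y, hy⟩ := (h.exists_realize (χ.relabel (splitLast ι n))).1 ⟨fun _ => m, by
    rw [Formula.realize_relabel, elim_comp_splitLast]; exact h1⟩
  rw [Formula.realize_relabel, elim_comp_splitLast] at hy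
  exact ⟨y (), h.of_sumElim.of_isolating h2 hy⟩

theorem AtomicOver.of_sameType {a : ι → M} {a' : ι → N} (ha' : AtomicOver L a') (f : M ↪ₑ[L] N)
    (hf : f ∘ a = a') : AtomicOver L a := fun n b => by
  refine (ha' n (f ∘ b)).of_sameType ?_
  rw [← hf, ← Sum.comp_elim]
  exact (f.sameType _).symm

end Isolated

/-! ### Back and forth between atomic models -/

section BackAndForth

variable {L : Language.{u, v}} {M N : Type*} [L.Structure M] [L.Structure N] {ι : Type*}

/-- A sequence of pairs whose initial segments have coordinates of the same type, and whose first
coordinates exhaust the structure, is contained in the graph of an elementary embedding. -/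
theorem exists_elementaryEmbedding_of_seq {a : ι → M} {b : ι → N} (g : ℕ → M × N)
    (hg : ∀ n, SameType L (Sum.elim a fun i : Fin n => (g i).1)
      (Sum.elim b fun i : Fin n => (g i).2))
    (hs : ∀ m, ∃ n, (g n).1 = m) :
    ∃ f : M ↪ₑ[L] N, (∀ i, f (a i) = b i) ∧ ∀ n, f (g n).1 = (g n).2 := by
  choose k hk using hs
  have key : ∀ i j, (g i).1 = (g j).1 → (g i).2 = (g j).2 := by
    intro i j h
    have hi : i < max i j + 1 := by omega
    have hj : j < max i j + 1 := by omega
    have := hg (max i j + 1) (Term.equal (Term.var (Sum.inr ⟨i, hi⟩)) (Term.var (Sum.inr ⟨j, hj⟩)))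
    simpa [Formula.realize_equal, h] using this
  refine ⟨⟨fun m => (g (k m)).2, fun n φ x => ?_⟩, fun i => ?_, fun n => key _ _ (hk _)⟩
  · obtain ⟨B, hB⟩ : ∃ B, ∀ i, k (x i) < B := by
      obtain ⟨B, hB⟩ := (Set.finite_range fun i => k (x i)).bddAbove
      exact ⟨B + 1, fun i => Nat.lt_succ_of_le (hB ⟨i, rfl⟩)⟩
    have := (hg B).comp (fun i => Sum.inr ⟨k (x i), hB i⟩) φ
    simp only [Function.comp_def, Sum.elim_inr, hk] at this
    exact this.symm
  · have := hg (k (a i) + 1) (Term.equal (Term.var (Sum.inl i))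
      (Term.var (Sum.inr ⟨k (a i), by omega⟩)))
    simp only [Formula.realize_equal, Term.realize_var, Sum.elim_inl, Sum.elim_inr, hk,
      true_iff] at this
    exact this.symm

/-- A surjective elementary embedding is an isomorphism. -/
noncomputable def ElementaryEmbedding.equivOfSurjective (f : M ↪ₑ[L] N)
    (hf : Function.Surjective f) : M ≃[L] N where
  toEquiv := _root_.Equiv.ofBijective f ⟨f.injective, hf⟩
  map_fun' := f.map_fun
  map_rel' := f.map_rel

theorem fst_snoc {X Y : Type*} {n : ℕ} (t : Fin n → X × Y) (x : X × Y) :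
    (fun i => ((Fin.snoc t x : Fin (n + 1) → X × Y) i).1) =
      (Fin.snoc (fun i => (t i).1) x.1 : Fin (n + 1) → X) :=
  Fin.comp_snoc Prod.fst t x

theorem snd_snoc {X Y : Type*} {n : ℕ} (t : Fin n → X × Y) (x : X × Y) :
    (fun i => ((Fin.snoc t x : Fin (n + 1) → X × Y) i).2) =
      (Fin.snoc (fun i => (t i).2) x.2 : Fin (n + 1) → Y) :=
  Fin.comp_snoc Prod.snd t x

/-- A countable structure that is atomic over a tuple is prime over it. -/
theorem AtomicOver.exists_elementaryEmbedding [Countable M] [Nonempty M] {a : ι → M} {b : ι → N}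
    (ha : AtomicOver L a) (h : SameType L a b) :
    ∃ f : M ↪ₑ[L] N, ∀ i, f (a i) = b i := by
  obtain ⟨e, he⟩ := exists_surjective_nat M
  obtain ⟨g, hg⟩ := exists_seq_of_extend (X := M × N)
    (fun n t => SameType L (Sum.elim a fun i : Fin n => (t i).1)
      (Sum.elim b fun i : Fin n => (t i).2))
    (fun n _ x => x.1 = e n)
    (fun t => by
      have := h.comp (Sum.elim id Fin.elim0 : ι ⊕ Fin 0 → ι)
      convert this using 1 <;> ext (i | i) <;> first | rfl | exact i.elim0)
    (fun n t ht => by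
      obtain ⟨m', hm'⟩ := ht.exists_snoc (e n) (ha _ _)
      refine ⟨(e n, m'), ?_, rfl⟩
      simpa only [fst_snoc, snd_snoc] using hm')
  obtain ⟨f, hf, -⟩ := exists_elementaryEmbedding_of_seq g (fun n => (hg n).1) (fun m => by
    obtain ⟨n, rfl⟩ := he m
    exact ⟨n, (hg n).2⟩)
  exact ⟨f, hf⟩

/-- Countable structures that are atomic over tuples of the same type are isomorphic. -/
theorem AtomicOver.nonempty_equiv [Countable M] [Nonempty M] [Countable N] [Nonempty N] {a : ι → M}
    {b : ι → N} (ha : AtomicOver L a) (hb : AtomicOver L b) (h : SameType L a b) :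
    Nonempty (M ≃[L] N) := by
  obtain ⟨e, he⟩ := exists_surjective_nat M
  obtain ⟨e', he'⟩ := exists_surjective_nat N
  obtain ⟨g, hg⟩ := exists_seq_of_extend (X := M × N)
    (fun n t => SameType L (Sum.elim a fun i : Fin n => (t i).1)
      (Sum.elim b fun i : Fin n => (t i).2))
    -- even stages deal with an element of `M`, odd stages with an element of `N`
    (fun n _ x => (∀ k, n = 2 * k → x.1 = e k) ∧ ∀ k, n = 2 * k + 1 → x.2 = e' k)
    (fun t => by
      have := h.comp (Sum.elim id Fin.elim0 : ι ⊕ Fin 0 → ι)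
      convert this using 1 <;> ext (i | i) <;> first | rfl | exact i.elim0)
    (fun n t ht => by
      simp only [fst_snoc, snd_snoc]
      obtain ⟨k, rfl | rfl⟩ := Nat.even_or_odd' n
      · obtain ⟨m', hm'⟩ := ht.exists_snoc (e k) (ha _ _)
        refine ⟨(e k, m'), hm', fun j hj => ?_, fun j hj => ?_⟩
        · rw [show k = j by omega]
        · omega
      · obtain ⟨m', hm'⟩ := ht.symm.exists_snoc (e' k) (hb _ _)
        refine ⟨(m', e' k), hm'.symm, fun j hj => ?_, fun j hj => ?_⟩
        · omega
        · rw [show k = j by omega])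
  obtain ⟨f, -, hf⟩ := exists_elementaryEmbedding_of_seq g (fun n => (hg n).1) (fun m => by
    obtain ⟨n, rfl⟩ := he m
    exact ⟨2 * n, (hg _).2.1 n rfl⟩)
  refine ⟨f.equivOfSurjective fun y => ?_⟩
  obtain ⟨n, rfl⟩ := he' y
  exact ⟨_, (hf (2 * n + 1)).trans ((hg _).2.2 n rfl)⟩

end BackAndForth

/-! ### Prime models of theories with countably many countable models -/

section Small

variable {L : Language.{u, v}} {T : L.Theory}

/-- A countable model of `T` has a copy with universe in `Type`. -/
theorem exists_countableModel_equiv (M : Type w₁) [L.Structure M] [M ⊨ T] [Nonempty M]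
    [Countable M] : ∃ N : CountableModel T, Nonempty (M ≃[L] N.1) := by
  obtain ⟨N, _, ⟨e⟩⟩ := exists_equiv_type_zero (L := L) M
  have : N ⊨ T := (e.toElementaryEmbedding.theory_model_iff T).1 ‹_›
  have : Nonempty N := e.toEquiv.symm.nonempty
  exact ⟨⟨Theory.ModelType.of T N, e.symm.toEquiv.injective.countable⟩, ⟨e⟩⟩

variable [Countable L.Symbols]

/-- If `T` has only countably many countable models, then isolated types are dense: the tuples
satisfying a formula over a finite tuple `a` include one whose type over `a` is isolated. Otherwise
the formula could be strengthened step by step so as to exclude in turn all the (countably many)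
types realized in countable models, but by compactness all these strengthenings are jointly
satisfied in some countable model. -/
theorem exists_isolatedOver [Countable (CountableIsoType T)] {M : Type} [L.Structure M] [M ⊨ T]
    [Nonempty M] {ι β : Type} [Finite ι] [Finite β] (a : ι → M) (φ : L.Formula (ι ⊕ β))
    (hφ : ∃ b, φ.Realize (Sum.elim a b)) :
    ∃ b, φ.Realize (Sum.elim a b) ∧ IsolatedOver L a b := by
  by_contra! H
  let C : CountableIsoType T → CountableModel T := Quotient.out
  have (j : CountableIsoType T) : Countable (C j).1 := (C j).2
  let X := Σ j : CountableIsoType T, (ι ⊕ β → (C j).1)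
  obtain ⟨f, hf⟩ := Countable.exists_injective_nat X
  let S := {ψ : L.Formula (ι ⊕ β) // (∃ b, ψ.Realize (Sum.elim a b)) ∧
    ∀ b, ψ.Realize (Sum.elim a b) → φ.Realize (Sum.elim a b)}
  have step : ∀ (k : ℕ) (ψ : S), ∃ ψ' : S,
      (∀ b, ψ'.1.Realize (Sum.elim a b) → ψ.1.Realize (Sum.elim a b)) ∧
        ∀ x : X, f x = k → ¬ ψ'.1.Realize x.2 := by
    rintro k ⟨ψ, ⟨b, hb⟩, hψ⟩
    by_cases hk : ∃ x, f x = k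
    · obtain ⟨x, rfl⟩ := hk
      obtain ⟨θ, c, hc, hθb, hθc⟩ : ∃ (θ : L.Formula (ι ⊕ β)) (c : β → M),
          ψ.Realize (Sum.elim a c) ∧ θ.Realize (Sum.elim a b) ∧ ¬ θ.Realize (Sum.elim a c) := by
        by_contra! h
        exact H b (hψ b hb) ⟨ψ, hb, fun c hc => SameType.of_imp fun θ hθ => h θ c hc hθ⟩
      by_cases hx : θ.Realize x.2
      · refine ⟨⟨ψ ⊓ θ.not, ⟨c, Formula.realize_inf.2 ⟨hc, hθc⟩⟩,
          fun d hd => hψ d (Formula.realize_inf.1 hd).1⟩, fun d hd => (Formula.realize_inf.1 hd).1,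
          fun y hy h => ?_⟩
        obtain rfl := hf hy
        exact (Formula.realize_inf.1 h).2 hx
      · refine ⟨⟨ψ ⊓ θ, ⟨b, Formula.realize_inf.2 ⟨hb, hθb⟩⟩,
          fun d hd => hψ d (Formula.realize_inf.1 hd).1⟩, fun d hd => (Formula.realize_inf.1 hd).1,
          fun y hy h => ?_⟩
        obtain rfl := hf hy
        exact hx (Formula.realize_inf.1 h).2
    · exact ⟨⟨ψ, ⟨b, hb⟩, hψ⟩, fun _ h => h, fun x hx => (hk ⟨x, hx⟩).elim⟩
  choose F hF hF' using step
  let s : ℕ → S := Nat.rec ⟨φ, hφ, fun _ h => h⟩ F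
  have hs : ∀ i j, i ≤ j → ∀ b, (s j).1.Realize (Sum.elim a b) → (s i).1.Realize (Sum.elim a b) := by
    intro i j hij
    induction hij with
    | refl => exact fun _ h => h
    | step _ ih => exact fun b h => ih b (hF _ _ b h)
  choose c hc using fun k => (s k).2.1
  -- In an ultrapower of `M` some tuple satisfies all the formulas of the sequence.
  let U := Filter.hyperfilter ℕ
  let K := (U : Filter ℕ).Product fun _ => M
  let w : ι ⊕ β → K := fun i => ((fun k => Sum.elim a (c k) i : ℕ → M) : K)
  have hw : ∀ j, (s j).1.Realize w := fun j => by
    refine (Ultraproduct.realize_formula_cast (s j).1 fun i k => Sum.elim a (c k) i).2 ?_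
    exact ((Filter.eventually_ge_atTop j).filter_mono Nat.hyperfilter_le_atTop).mono
      fun k hk => hs j k hk _ (hc k)
  have hK : K ⊨ T := (Theory.model_iff T).2 fun σ hσ =>
    (Ultraproduct.sentence_realize σ).2 (Filter.Eventually.of_forall fun _ =>
      Theory.realize_sentence_of_mem T hσ)
  obtain ⟨E, hE, hEc⟩ := exists_countable_elementarySubstructure (L := L) (Set.range w)
    (Set.countable_range w)
  have hET : E ⊨ T := (E.theory_model_iff T).2 hK
  have : Nonempty K := Ultraproduct.Product.instNonempty
  have hEn : Nonempty E := E.elementarilyEquivalent.nonempty_iff.2 this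
  obtain ⟨N, ⟨e⟩⟩ := exists_countableModel_equiv (T := T) E
  obtain ⟨e'⟩ : Nonempty (N.1 ≃[L] (C (Quotient.mk _ N)).1) :=
    Quotient.exact (Quotient.out_eq (Quotient.mk (countableModelSetoid T) N)).symm
  let x : X := ⟨Quotient.mk _ N, e' ∘ e ∘ fun i => ⟨w i, hE ⟨i, rfl⟩⟩⟩
  refine hF' (f x) (s (f x)) x rfl ?_
  refine (e'.sameType _ _).1 ((e.sameType _ _).1 ((E.subtype.sameType _ _).2 ?_))
  exact hw (f x + 1)

/-- If `T` has only countably many countable models, then a finite tuple of a model lies in a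
countable elementary substructure that is atomic over it. -/
theorem exists_atomicOver [Countable (CountableIsoType T)] {M : Type} [L.Structure M] [M ⊨ T]
    [Nonempty M] {ι : Type} [Finite ι] (a : ι → M) :
    ∃ E : L.ElementarySubstructure M, Countable E ∧
      ∃ a' : ι → E, (∀ i, (a' i : M) = a i) ∧ AtomicOver L a' := by
  obtain ⟨e, he⟩ := exists_surjective_nat (Σ m, L.Formula (ι ⊕ Fin (m + 1)))
  obtain ⟨g, hg⟩ := exists_seq_of_extend (X := M) (fun n t => IsolatedOver L a t)
    -- stage `n` provides a witness for the formula with the number `n.unpair.1`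
    (fun n t x => ∀ h : (e n.unpair.1).1 ≤ n,
      (∃ y, (e n.unpair.1).2.Realize
        (Sum.elim a (Fin.snoc (fun i => t (Fin.castLE h i)) y : Fin (_ + 1) → M))) →
      (e n.unpair.1).2.Realize
        (Sum.elim a (Fin.snoc (fun i => t (Fin.castLE h i)) x : Fin (_ + 1) → M)))
    (fun t => ⟨⊤, Formula.realize_top.2 trivial, fun c _ => by
      rw [Subsingleton.elim t c]; exact fun _ => Iff.rfl⟩)
    (by
      intro n t ht
      -- It suffices to extend `t` by an element of isolated type that satisfies a given formula.
      have key : ∀ φ : L.Formula (ι ⊕ Fin (n + 1)),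
          (∃ y, φ.Realize (Sum.elim a (Fin.snoc t y : Fin (n + 1) → M))) →
          ∃ x, IsolatedOver L a (Fin.snoc t x : Fin (n + 1) → M) ∧
            φ.Realize (Sum.elim a (Fin.snoc t x : Fin (n + 1) → M)) := by
        rintro φ ⟨y, hy⟩
        obtain ⟨χ, h1, h2⟩ := ht
        let k : ι ⊕ Fin n → ι ⊕ Fin (n + 1) := Sum.map id Fin.castSucc
        have hk : ∀ b : Fin (n + 1) → M, Sum.elim a b ∘ k = Sum.elim a (b ∘ Fin.castSucc) :=
          fun b => by ext (i | i) <;> rfl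
        obtain ⟨b, hb, hbi⟩ := exists_isolatedOver (T := T) a (φ ⊓ χ.relabel k) ⟨Fin.snoc t y, by
          rw [Formula.realize_inf, Formula.realize_relabel, hk]
          refine ⟨hy, ?_⟩
          convert h1
          ext i; simp⟩
        rw [Formula.realize_inf, Formula.realize_relabel, hk] at hb
        have hb' : (Fin.snoc (b ∘ Fin.castSucc) (b (Fin.last n)) : Fin (n + 1) → M) = b :=
          Fin.snoc_init_self b
        obtain ⟨x, hx⟩ := (h2 _ hb.2).symm.exists_snoc (b (Fin.last n)) (by rwa [hb'])
        rw [hb'] at hx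
        exact ⟨x, hbi.of_sameType hx, (hx φ).1 hb.1⟩
      by_cases h : ∃ h : (e n.unpair.1).1 ≤ n, ∃ y, (e n.unpair.1).2.Realize
        (Sum.elim a (Fin.snoc (fun i => t (Fin.castLE h i)) y : Fin (_ + 1) → M))
      · obtain ⟨h, hy⟩ := h
        let k : ι ⊕ Fin ((e n.unpair.1).1 + 1) → ι ⊕ Fin (n + 1) :=
          Sum.map id (Fin.snoc (fun i => (Fin.castLE h i).castSucc) (Fin.last n))
        have hk : ∀ y, Sum.elim a (Fin.snoc t y : Fin (n + 1) → M) ∘ k =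
            Sum.elim a (Fin.snoc (fun i => t (Fin.castLE h i)) y : Fin (_ + 1) → M) := by
          intro y
          ext (i | i)
          · rfl
          · refine Fin.lastCases ?_ (fun j => ?_) i <;>
              simp only [k, Function.comp_apply, Sum.map_inr, Sum.elim_inr, Fin.snoc_castSucc,
                Fin.snoc_last]
        obtain ⟨x, hx, hx'⟩ := key ((e n.unpair.1).2.relabel k) (by
          simpa only [Formula.realize_relabel, hk] using hy)
        rw [Formula.realize_relabel, hk] at hx'
        exact ⟨x, hx, fun _ _ => hx'⟩
      · obtain ⟨x, hx, -⟩ := key ⊤ ⟨Classical.arbitrary M, Formula.realize_top.2 trivial⟩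
        exact ⟨x, hx, fun h' hy => (h ⟨h', hy⟩).elim⟩)
  have wit : ∀ m (φ : L.Formula (ι ⊕ Fin (m + 1))),
      (∃ y, φ.Realize (Sum.elim a (Fin.snoc (fun i : Fin m => g i) y : Fin (m + 1) → M))) →
      ∃ k, φ.Realize (Sum.elim a (Fin.snoc (fun i : Fin m => g i) (g k) : Fin (m + 1) → M)) := by
    intro m φ hy
    obtain ⟨j, hj⟩ := he ⟨m, φ⟩
    have := (hg (Nat.pair j m)).2
    rw [Nat.unpair_pair, hj] at this
    exact ⟨_, this (Nat.right_le_pair j m) hy⟩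
  have bound : ∀ {κ : Type} [Finite κ] (k : κ → ℕ), ∃ B, ∀ i, k i < B := fun k => by
    obtain ⟨B, hB⟩ := (Set.finite_range k).bddAbove
    exact ⟨B + 1, fun i => Nat.lt_succ_of_le (hB ⟨i, rfl⟩)⟩
  obtain ⟨E, hE⟩ := exists_elementarySubstructure_of_test (L := L) (Set.range g) (by
    intro n φ x hx hy
    choose k hk using hx
    obtain ⟨B, hB⟩ := bound k
    let r : Fin (n + 1) → ι ⊕ Fin (B + 1) :=
      Fin.snoc (α := fun _ => ι ⊕ Fin (B + 1)) (fun i => Sum.inr (Fin.castSucc ⟨k i, hB i⟩))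
        (Sum.inr (Fin.last B))
    have hr : ∀ y, Sum.elim a (Fin.snoc (fun i : Fin B => g i) y : Fin (B + 1) → M) ∘ r =
        (Fin.snoc x y : Fin (n + 1) → M) := by
      intro y
      ext i
      refine Fin.lastCases ?_ (fun j => ?_) i <;> simp [r, -Fin.castSucc_mk, hk]
    obtain ⟨j, hj⟩ := wit B (φ.relabel r) (by simpa only [Formula.realize_relabel, hr] using hy)
    rw [Formula.realize_relabel, hr] at hj
    exact ⟨g j, ⟨j, rfl⟩, hj⟩)
  have hmem : ∀ y : M, y ∈ E ↔ y ∈ Set.range g := fun y => by rw [← hE]; rfl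
  have ha : ∀ i, a i ∈ E := fun i => by
    obtain ⟨k, hk⟩ := wit 0 (Term.equal (Term.var (Sum.inl i)) (Term.var (Sum.inr (Fin.last 0))))
      ⟨a i, by simp [Formula.realize_equal, Fin.snoc]⟩
    refine (hmem _).2 ⟨k, ?_⟩
    simpa [Formula.realize_equal, Fin.snoc] using hk.symm
  have hc : Countable E := by
    have : (E : Set M).Countable := hE ▸ Set.countable_range g
    exact this.to_subtype
  refine ⟨E, hc, fun i => ⟨a i, ha i⟩, fun i => rfl, fun n b => ?_⟩
  choose k hk using fun i => (hmem (b i)).1 (b i).2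
  obtain ⟨B, hB⟩ := bound k
  have := (hg B).1.comp fun i => (⟨k i, hB i⟩ : Fin B)
  have hb : (fun i : Fin B => g i) ∘ (fun i => (⟨k i, hB i⟩ : Fin B)) = E.subtype ∘ b :=
    funext hk
  rw [hb] at this
  refine this.of_sameType ?_
  have h := (E.subtype.sameType (Sum.elim (fun i => ⟨a i, ha i⟩) b)).symm
  rwa [Sum.comp_elim] at h

end Small

/-! ### Models prime over finite tuples -/

section Prime

variable {L : Language.{u, v}}

theorem isPrimeOverFinite_of_finite {M : Type} [L.Structure M] {ι : Type} [Finite ι] (a : ι → M)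
    (h : ∀ (N : Type) [L.Structure N] (b : ι → N), SameType L a b →
      ∃ f : M ↪ₑ[L] N, ∀ i, f (a i) = b i) : IsPrimeOverFinite L M := by
  obtain ⟨n, ⟨e⟩⟩ := Finite.exists_equiv_fin ι
  refine ⟨n, a ∘ e.symm, fun N _ b hb => ?_⟩
  obtain ⟨f, hf⟩ := h N (b ∘ e) (by
    have := SameType.comp (L := L) hb e
    rwa [Function.comp_assoc, e.symm_comp_self, Function.comp_id] at this)
  exact ⟨f, fun i => by simp [hf]⟩

theorem AtomicOver.isPrimeOverFinite {M : Type} [L.Structure M] [Countable M] [Nonempty M]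
    {ι : Type} [Finite ι] {a : ι → M} (h : AtomicOver L a) : IsPrimeOverFinite L M :=
  isPrimeOverFinite_of_finite a fun _ _ _ hb => h.exists_elementaryEmbedding hb

theorem IsPrimeOverFinite.of_equiv {M N : Type} [L.Structure M] [L.Structure N]
    (h : IsPrimeOverFinite L M) (e : M ≃[L] N) : IsPrimeOverFinite L N := by
  obtain ⟨n, a, ha⟩ := h
  refine ⟨n, e ∘ a, fun K _ b hb => ?_⟩
  obtain ⟨f, hf⟩ := ha K b ((e.sameType a).trans hb)
  refine ⟨f.comp e.symm.toElementaryEmbedding, fun i => ?_⟩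
  rw [← hf i]
  exact congrArg f (e.symm_apply_apply (a i))

end Prime

/-! ### Formulas in disjoint unions: decomposition into rectangles -/

section FefermanVaught

variable {L₁ : Language.{u₁, v₁}} {L₂ : Language.{u₂, v₂}}

namespace disjointLanguage

/-- The variable that a term of the relational language `disjointLanguage L₁ L₂` consists of. -/
def termVar {X : Type*} : (disjointLanguage L₁ L₂).Term X → X
  | .var x => x
  | .func f _ => Empty.elim f

theorem realize_eq_termVar {X A : Type*} [(disjointLanguage L₁ L₂).Structure A]
    (t : (disjointLanguage L₁ L₂).Term X) (v : X → A) : t.realize v = v (termVar t) := by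
  cases t with
  | var x => rfl
  | func f _ => exact Empty.elim f

end disjointLanguage

open disjointLanguage

variable {α β γ : Type*} {k m n : ℕ}

/-- A finite list of pairs of formulas, one in each language. A pair stands for a rectangle, the
list for the union of its rectangles. -/
abbrev RectList (L₁ : Language.{u₁, v₁}) (L₂ : Language.{u₂, v₂}) (α β : Type*) (k m : ℕ) :=
  List (L₁.BoundedFormula α k × L₂.BoundedFormula β m)

namespace RectList

variable {M N : Type*} [L₁.Structure M] [L₂.Structure N]
  {v : α → M} {xs : Fin k → M} {w : β → N} {ys : Fin m → N}

/-- Membership of a pair of assignments in the union of the rectangles. -/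
def Realize (l : RectList L₁ L₂ α β k m) (v : α → M) (xs : Fin k → M) (w : β → N)
    (ys : Fin m → N) : Prop :=
  ∃ p ∈ l, p.1.Realize v xs ∧ p.2.Realize w ys

theorem realize_append {l l' : RectList L₁ L₂ α β k m} :
    Realize (l ++ l') v xs w ys ↔ Realize l v xs w ys ∨ Realize l' v xs w ys := by
  simp only [Realize, List.mem_append, or_and_right, exists_or]

/-- The intersection of two unions of rectangles. -/
def inter (l l' : RectList L₁ L₂ α β k m) : RectList L₁ L₂ α β k m :=
  (l.product l').map fun p => (p.1.1 ⊓ p.2.1, p.1.2 ⊓ p.2.2)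

theorem realize_inter {l l' : RectList L₁ L₂ α β k m} :
    (inter l l').Realize v xs w ys ↔ Realize l v xs w ys ∧ Realize l' v xs w ys := by
  simp only [Realize, inter, List.mem_map]
  constructor
  · rintro ⟨_, ⟨⟨p, q⟩, hpq, rfl⟩, h⟩
    rw [List.pair_mem_product] at hpq
    simp only [BoundedFormula.realize_inf] at h
    exact ⟨⟨p, hpq.1, h.1.1, h.2.1⟩, ⟨q, hpq.2, h.1.2, h.2.2⟩⟩
  · rintro ⟨⟨p, hp, h⟩, ⟨q, hq, h'⟩⟩
    refine ⟨_, ⟨⟨p, q⟩, List.pair_mem_product.2 ⟨hp, hq⟩, rfl⟩, ?_⟩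
    simp only [BoundedFormula.realize_inf]
    exact ⟨⟨h.1, h'.1⟩, ⟨h.2, h'.2⟩⟩

/-- The complement of a union of rectangles. -/
def compl : RectList L₁ L₂ α β k m → RectList L₁ L₂ α β k m
  | [] => [(⊤, ⊤)]
  | p :: l => inter [(p.1.not, ⊤), (⊤, p.2.not)] (compl l)

theorem realize_compl {l : RectList L₁ L₂ α β k m} :
    (compl l).Realize v xs w ys ↔ ¬ Realize l v xs w ys := by
  induction l with
  | nil => simp [compl, Realize]
  | cons p l ih =>
    rw [compl, realize_inter, ih]
    simp only [Realize, List.mem_cons, List.not_mem_nil, or_false, exists_eq_or_imp, exists_eq_left,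
      BoundedFormula.realize_not, BoundedFormula.realize_top, and_true, true_and, not_or,
      not_and_or]

/-- The projection of a union of rectangles along the last variable of the left side. -/
def exLeft (l : RectList L₁ L₂ α β (k + 1) m) : RectList L₁ L₂ α β k m :=
  l.map fun p => (p.1.ex, p.2)

/-- The projection of a union of rectangles along the last variable of the right side. -/
def exRight (l : RectList L₁ L₂ α β k (m + 1)) : RectList L₁ L₂ α β k m :=
  l.map fun p => (p.1, p.2.ex)

theorem realize_exLeft {l : RectList L₁ L₂ α β (k + 1) m} :
    (exLeft l).Realize v xs w ys ↔ ∃ x : M, Realize l v (Fin.snoc xs x) w ys := by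
  simp only [Realize, exLeft, List.mem_map]
  constructor
  · rintro ⟨_, ⟨p, hp, rfl⟩, hx, h⟩
    obtain ⟨x, hx⟩ := BoundedFormula.realize_ex.1 hx
    exact ⟨x, p, hp, hx, h⟩
  · rintro ⟨x, p, hp, hx, h⟩
    exact ⟨_, ⟨p, hp, rfl⟩, BoundedFormula.realize_ex.2 ⟨x, hx⟩, h⟩

theorem realize_exRight {l : RectList L₁ L₂ α β k (m + 1)} :
    (exRight l).Realize v xs w ys ↔ ∃ y : N, Realize l v xs w (Fin.snoc ys y) := by
  simp only [Realize, exRight, List.mem_map]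
  constructor
  · rintro ⟨_, ⟨p, hp, rfl⟩, h, hx⟩
    obtain ⟨x, hx⟩ := BoundedFormula.realize_ex.1 hx
    exact ⟨x, p, hp, h, hx⟩
  · rintro ⟨x, p, hp, h, hx⟩
    exact ⟨_, ⟨p, hp, rfl⟩, h, BoundedFormula.realize_ex.2 ⟨x, hx⟩⟩

open Classical in
/-- The condition `F` on the variables `x`, if they all belong to the left side; the
empty union otherwise. -/
noncomputable def atomLeft {X Y : Type*} (x : Fin n → X ⊕ Y)
    (F : (Fin n → X) → L₁.BoundedFormula α k) : RectList L₁ L₂ α β k m :=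
  if h : ∃ y : Fin n → X, x = Sum.inl ∘ y then [(F h.choose, ⊤)] else []

open Classical in
/-- The condition `F` on the variables `x`, if they all belong to the right side; the
empty union otherwise. -/
noncomputable def atomRight {X Y : Type*} (x : Fin n → X ⊕ Y)
    (F : (Fin n → Y) → L₂.BoundedFormula β m) : RectList L₁ L₂ α β k m :=
  if h : ∃ y : Fin n → Y, x = Sum.inr ∘ y then [(⊤, F h.choose)] else []

theorem realize_atomLeft {X Y : Type*} {x : Fin n → X ⊕ Y}
    {F : (Fin n → X) → L₁.BoundedFormula α k} :
    (atomLeft x F : RectList L₁ L₂ α β k m).Realize v xs w ys ↔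
      ∃ y, x = Sum.inl ∘ y ∧ (F y).Realize v xs := by
  unfold atomLeft
  split_ifs with h
  · simp only [Realize, List.mem_singleton, exists_eq_left, BoundedFormula.realize_top, and_true]
    refine ⟨fun h' => ⟨_, h.choose_spec, h'⟩, ?_⟩
    rintro ⟨y, hy, h'⟩
    rwa [Sum.inl_injective.comp_left (h.choose_spec.symm.trans hy)]
  · simp only [Realize, List.not_mem_nil, false_and, exists_false, false_iff]
    rintro ⟨y, hy, -⟩
    exact h ⟨y, hy⟩

theorem realize_atomRight {X Y : Type*} {x : Fin n → X ⊕ Y}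
    {F : (Fin n → Y) → L₂.BoundedFormula β m} :
    (atomRight x F : RectList L₁ L₂ α β k m).Realize v xs w ys ↔
      ∃ y, x = Sum.inr ∘ y ∧ (F y).Realize w ys := by
  unfold atomRight
  split_ifs with h
  · simp only [Realize, List.mem_singleton, exists_eq_left, BoundedFormula.realize_top, true_and]
    refine ⟨fun h' => ⟨_, h.choose_spec, h'⟩, ?_⟩
    rintro ⟨y, hy, h'⟩
    rwa [Sum.inr_injective.comp_left (h.choose_spec.symm.trans hy)]
  · simp only [Realize, List.not_mem_nil, false_and, exists_false, false_iff]
    rintro ⟨y, hy, -⟩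
    exact h ⟨y, hy⟩

end RectList

open RectList

/-- An assignment of the variables of a formula to variables on either side, extended by the next
bound variable, which goes to the left side. -/
def snocLeft (s : γ ⊕ Fin n → (α ⊕ Fin k) ⊕ (β ⊕ Fin m)) :
    γ ⊕ Fin (n + 1) → (α ⊕ Fin (k + 1)) ⊕ (β ⊕ Fin m) :=
  Sum.elim (Sum.map (Sum.map id Fin.castSucc) id ∘ s ∘ Sum.inl)
    (Fin.snoc (α := fun _ => (α ⊕ Fin (k + 1)) ⊕ (β ⊕ Fin m))
      (Sum.map (Sum.map id Fin.castSucc) id ∘ s ∘ Sum.inr) (Sum.inl (Sum.inr (Fin.last k))))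

/-- An assignment of the variables of a formula to variables on either side, extended by the next
bound variable, which goes to the right side. -/
def snocRight (s : γ ⊕ Fin n → (α ⊕ Fin k) ⊕ (β ⊕ Fin m)) :
    γ ⊕ Fin (n + 1) → (α ⊕ Fin k) ⊕ (β ⊕ Fin (m + 1)) :=
  Sum.elim (Sum.map id (Sum.map id Fin.castSucc) ∘ s ∘ Sum.inl)
    (Fin.snoc (α := fun _ => (α ⊕ Fin k) ⊕ (β ⊕ Fin (m + 1)))
      (Sum.map id (Sum.map id Fin.castSucc) ∘ s ∘ Sum.inr) (Sum.inr (Sum.inr (Fin.last m))))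

/-- The rectangles of an atomic formula that is not an equation. -/
noncomputable def relRects {n : ℕ} (R : (disjointLanguage L₁ L₂).Relations n)
    (x : Fin n → (α ⊕ Fin k) ⊕ (β ⊕ Fin m)) : RectList L₁ L₂ α β k m :=
  match R with
  | DisjointRel.relLeft R => atomLeft x fun y => R.boundedFormula fun i => Term.var (y i)
  | DisjointRel.relRight R => atomRight x fun y => R.boundedFormula fun i => Term.var (y i)
  | DisjointRel.graphLeft f => atomLeft x fun y =>
      (func f fun i => Term.var (y i.castSucc)).bdEqual (Term.var (y (Fin.last _)))
  | DisjointRel.graphRight f => atomRight x fun y =>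
      (func f fun i => Term.var (y i.castSucc)).bdEqual (Term.var (y (Fin.last _)))
  | DisjointRel.partLeft => atomLeft x fun _ => ⊤
  | DisjointRel.partRight => atomRight x fun _ => ⊤

/-- The set defined by a formula in disjoint unions, as a finite union of rectangles. The map `s`
tells which variables of the formula are to take values on which side. -/
noncomputable def rects : ∀ {n : ℕ}, (disjointLanguage L₁ L₂).BoundedFormula γ n → ∀ {k m : ℕ},
    (γ ⊕ Fin n → (α ⊕ Fin k) ⊕ (β ⊕ Fin m)) → RectList L₁ L₂ α β k m
  | _, .falsum, _, _, _ => []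
  | _, .equal t₁ t₂, _, _, s =>
      atomLeft ![s (termVar t₁), s (termVar t₂)]
          (fun y => (Term.var (y 0)).bdEqual (Term.var (y 1))) ++
        atomRight ![s (termVar t₁), s (termVar t₂)]
          (fun y => (Term.var (y 0)).bdEqual (Term.var (y 1)))
  | _, .rel R ts, _, _, s => relRects R fun i => s (termVar (ts i))
  | _, .imp φ ψ, _, _, s => compl (rects φ s) ++ rects ψ s
  | _, .all φ, _, _, s =>
      inter (compl (exLeft (compl (rects φ (snocLeft s)))))
        (compl (exRight (compl (rects φ (snocRight s)))))

variable {M N : Type*} [L₁.Structure M] [L₂.Structure N]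

/-- The value in `M ⊕ N` of variables that are assigned to variables on either side. -/
def sumVal (v : α → M) (xs : Fin k → M) (w : β → N) (ys : Fin m → N) :
    (α ⊕ Fin k) ⊕ (β ⊕ Fin m) → M ⊕ N :=
  Sum.map (Sum.elim v xs) (Sum.elim w ys)

theorem sumVal_comp_snocLeft (s : γ ⊕ Fin n → (α ⊕ Fin k) ⊕ (β ⊕ Fin m)) (v : α → M)
    (xs : Fin k → M) (w : β → N) (ys : Fin m → N) (x : M) :
    sumVal v (Fin.snoc xs x : Fin (k + 1) → M) w ys ∘ snocLeft s =
      Sum.elim (sumVal v xs w ys ∘ s ∘ Sum.inl)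
        (Fin.snoc (sumVal v xs w ys ∘ s ∘ Sum.inr) (Sum.inl x) : Fin (n + 1) → M ⊕ N) := by
  have key : sumVal v (Fin.snoc xs x : Fin (k + 1) → M) w ys ∘ Sum.map (Sum.map id Fin.castSucc) id
      = sumVal v xs w ys := by
    ext ((i | i) | (i | i)) <;> simp [sumVal]
  ext (i | i)
  · exact congrFun key (s (Sum.inl i))
  · refine Fin.lastCases ?_ (fun j => ?_) i
    · simp [snocLeft, sumVal]
    · simpa [snocLeft] using congrFun key (s (Sum.inr j))

theorem sumVal_comp_snocRight (s : γ ⊕ Fin n → (α ⊕ Fin k) ⊕ (β ⊕ Fin m)) (v : α → M)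
    (xs : Fin k → M) (w : β → N) (ys : Fin m → N) (y : N) :
    sumVal v xs w (Fin.snoc ys y : Fin (m + 1) → N) ∘ snocRight s =
      Sum.elim (sumVal v xs w ys ∘ s ∘ Sum.inl)
        (Fin.snoc (sumVal v xs w ys ∘ s ∘ Sum.inr) (Sum.inr y) : Fin (n + 1) → M ⊕ N) := by
  have key : sumVal v xs w (Fin.snoc ys y : Fin (m + 1) → N) ∘ Sum.map id (Sum.map id Fin.castSucc)
      = sumVal v xs w ys := by
    ext ((i | i) | (i | i)) <;> simp [sumVal]
  ext (i | i)
  · exact congrFun key (s (Sum.inl i))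
  · refine Fin.lastCases ?_ (fun j => ?_) i
    · simp [snocRight, sumVal]
    · simpa [snocRight] using congrFun key (s (Sum.inr j))

theorem sumVal_eq_inl_iff {l : ℕ} {v : α → M} {xs : Fin k → M} {w : β → N} {ys : Fin m → N}
    {x : Fin l → (α ⊕ Fin k) ⊕ (β ⊕ Fin m)} {a : Fin l → M} :
    (∀ i, sumVal v xs w ys (x i) = Sum.inl (a i)) ↔
      ∃ y, x = Sum.inl ∘ y ∧ ∀ i, Sum.elim v xs (y i) = a i := by
  constructor
  · intro h
    have : ∀ i, ∃ z, x i = Sum.inl z ∧ Sum.elim v xs z = a i := fun i => by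
      have hi := h i
      rcases hx : x i with z | z <;> rw [hx] at hi <;> simp [sumVal] at hi
      exact ⟨z, rfl, hi⟩
    choose y hy hy' using this
    exact ⟨y, funext hy, hy'⟩
  · rintro ⟨y, rfl, hy⟩ i
    simp [sumVal, hy]

theorem sumVal_eq_inr_iff {l : ℕ} {v : α → M} {xs : Fin k → M} {w : β → N} {ys : Fin m → N}
    {x : Fin l → (α ⊕ Fin k) ⊕ (β ⊕ Fin m)} {a : Fin l → N} :
    (∀ i, sumVal v xs w ys (x i) = Sum.inr (a i)) ↔
      ∃ y, x = Sum.inr ∘ y ∧ ∀ i, Sum.elim w ys (y i) = a i := by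
  constructor
  · intro h
    have : ∀ i, ∃ z, x i = Sum.inr z ∧ Sum.elim w ys z = a i := fun i => by
      have hi := h i
      rcases hx : x i with z | z <;> rw [hx] at hi <;> simp [sumVal] at hi
      exact ⟨z, rfl, hi⟩
    choose y hy hy' using this
    exact ⟨y, funext hy, hy'⟩
  · rintro ⟨y, rfl, hy⟩ i
    simp [sumVal, hy]

/-- A condition on the left side, in the form in which the structure on `M ⊕ N` states it. -/
theorem realize_atomLeft_iff {l : ℕ} {v : α → M} {xs : Fin k → M} {w : β → N} {ys : Fin m → N}
    {x : Fin l → (α ⊕ Fin k) ⊕ (β ⊕ Fin m)} {F : (Fin l → α ⊕ Fin k) → L₁.BoundedFormula α k}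
    {Q : (Fin l → M) → Prop} (h : ∀ y, (F y).Realize v xs ↔ Q (Sum.elim v xs ∘ y)) :
    (atomLeft x F : RectList L₁ L₂ α β k m).Realize v xs w ys ↔
      ∃ a, (∀ i, sumVal v xs w ys (x i) = Sum.inl (a i)) ∧ Q a := by
  simp only [realize_atomLeft, sumVal_eq_inl_iff, h]
  constructor
  · rintro ⟨y, hy, hQ⟩
    exact ⟨_, ⟨y, hy, fun i => rfl⟩, hQ⟩
  · rintro ⟨a, ⟨y, hy, ha⟩, hQ⟩
    refine ⟨y, hy, ?_⟩
    rwa [show Sum.elim v xs ∘ y = a from funext ha]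

/-- A condition on the right side, in the form in which the structure on `M ⊕ N` states it. -/
theorem realize_atomRight_iff {l : ℕ} {v : α → M} {xs : Fin k → M} {w : β → N} {ys : Fin m → N}
    {x : Fin l → (α ⊕ Fin k) ⊕ (β ⊕ Fin m)} {F : (Fin l → β ⊕ Fin m) → L₂.BoundedFormula β m}
    {Q : (Fin l → N) → Prop} (h : ∀ y, (F y).Realize w ys ↔ Q (Sum.elim w ys ∘ y)) :
    (atomRight x F : RectList L₁ L₂ α β k m).Realize v xs w ys ↔
      ∃ a, (∀ i, sumVal v xs w ys (x i) = Sum.inr (a i)) ∧ Q a := by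
  simp only [realize_atomRight, sumVal_eq_inr_iff, h]
  constructor
  · rintro ⟨y, hy, hQ⟩
    exact ⟨_, ⟨y, hy, fun i => rfl⟩, hQ⟩
  · rintro ⟨a, ⟨y, hy, ha⟩, hQ⟩
    refine ⟨y, hy, ?_⟩
    rwa [show Sum.elim w ys ∘ y = a from funext ha]

theorem realize_relRects {l : ℕ} (R : (disjointLanguage L₁ L₂).Relations l)
    (x : Fin l → (α ⊕ Fin k) ⊕ (β ⊕ Fin m)) (v : α → M) (xs : Fin k → M) (w : β → N)
    (ys : Fin m → N) :
    (relRects R x).Realize v xs w ys ↔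
      Structure.RelMap R
        fun i => sumVal v xs w ys (x i) := by
  cases R with
  | relLeft R =>
    rw [relRects, realize_atomLeft_iff fun y => Iff.rfl]
    rfl
  | relRight R =>
    rw [relRects, realize_atomRight_iff fun y => Iff.rfl]
    rfl
  | graphLeft f =>
    rw [relRects, realize_atomLeft_iff (Q := fun a => Structure.funMap f (fun i => a i.castSucc) =
      a (Fin.last _)) fun y => by simp]
    constructor
    · rintro ⟨a, ha, h⟩
      exact ⟨fun i => a i.castSucc, fun i => ha _, (ha _).trans (by rw [h])⟩
    · rintro ⟨a, ha, h⟩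
      exact ⟨Fin.snoc a (Structure.funMap f a), Fin.lastCases (by simpa using h)
        (by simpa using ha), by simp⟩
  | graphRight f =>
    rw [relRects, realize_atomRight_iff (Q := fun a => Structure.funMap f (fun i => a i.castSucc) =
      a (Fin.last _)) fun y => by simp]
    constructor
    · rintro ⟨a, ha, h⟩
      exact ⟨fun i => a i.castSucc, fun i => ha _, (ha _).trans (by rw [h])⟩
    · rintro ⟨a, ha, h⟩
      exact ⟨Fin.snoc a (Structure.funMap f a), Fin.lastCases (by simpa using h)
        (by simpa using ha), by simp⟩
  | partLeft =>
    rw [relRects, realize_atomLeft_iff (Q := fun _ => True) fun y => by simp]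
    constructor
    · rintro ⟨a, ha, -⟩
      exact ⟨a 0, ha 0⟩
    · rintro ⟨a, ha⟩
      exact ⟨fun _ => a, fun i => by rw [Subsingleton.elim i 0]; exact ha, trivial⟩
  | partRight =>
    rw [relRects, realize_atomRight_iff (Q := fun _ => True) fun y => by simp]
    constructor
    · rintro ⟨a, ha, -⟩
      exact ⟨a 0, ha 0⟩
    · rintro ⟨a, ha⟩
      exact ⟨fun _ => a, fun i => by rw [Subsingleton.elim i 0]; exact ha, trivial⟩

theorem elim_comp_inl_inr {X Y A B : Type*} (h : Y → X) (s : A ⊕ B → Y) :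
    Sum.elim (h ∘ s ∘ Sum.inl) (h ∘ s ∘ Sum.inr) = h ∘ s := by
  ext (i | i) <;> rfl

/-- The composition theorem of Feferman and Vaught, for disjoint unions of two structures. -/
theorem realize_rects (φ : (disjointLanguage L₁ L₂).BoundedFormula γ n)
    (s : γ ⊕ Fin n → (α ⊕ Fin k) ⊕ (β ⊕ Fin m)) (v : α → M) (xs : Fin k → M) (w : β → N)
    (ys : Fin m → N) :
    (rects φ s).Realize v xs w ys ↔
      φ.Realize (sumVal v xs w ys ∘ s ∘ Sum.inl) (sumVal v xs w ys ∘ s ∘ Sum.inr) := by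
  induction φ generalizing k m with
  | falsum => simp [rects, RectList.Realize, BoundedFormula.Realize]
  | equal t₁ t₂ =>
    rw [rects, realize_append,
      realize_atomLeft_iff (Q := fun a => a 0 = a 1) (fun y => by simp),
      realize_atomRight_iff (Q := fun a => a 0 = a 1) (fun y => by simp)]
    simp only [BoundedFormula.Realize, realize_eq_termVar, elim_comp_inl_inr]
    simp only [Function.comp_apply, Fin.forall_fin_two, Matrix.cons_val_zero, Matrix.cons_val_one]
    constructor
    · rintro (⟨a, h, h'⟩ | ⟨a, h, h'⟩) <;> rw [h.1, h.2, h']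
    · intro h
      rw [h]
      rcases sumVal v xs w ys (s (termVar t₂)) with a | a
      · exact Or.inl ⟨fun _ => a, ⟨rfl, rfl⟩, rfl⟩
      · exact Or.inr ⟨fun _ => a, ⟨rfl, rfl⟩, rfl⟩
  | rel R ts =>
    rw [rects, realize_relRects]
    simp only [BoundedFormula.Realize, realize_eq_termVar, elim_comp_inl_inr]
    rfl
  | imp φ ψ ih₁ ih₂ =>
    rw [rects, realize_append, realize_compl, ih₁ s xs ys, ih₂ s xs ys,
      BoundedFormula.realize_imp, imp_iff_not_or]
  | all φ ih =>
    rw [rects, realize_inter, realize_compl, realize_compl, realize_exLeft, realize_exRight]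
    simp only [realize_compl, not_exists, not_not, BoundedFormula.realize_all, Sum.forall]
    refine and_congr (forall_congr' fun x => ?_) (forall_congr' fun y => ?_)
    · rw [ih]
      rw [← Function.comp_assoc, ← Function.comp_assoc, sumVal_comp_snocLeft s v xs w ys x,
        Sum.elim_comp_inl, Sum.elim_comp_inr]
    · rw [ih]
      rw [← Function.comp_assoc, ← Function.comp_assoc, sumVal_comp_snocRight s v xs w ys y,
        Sum.elim_comp_inl, Sum.elim_comp_inr]

variable {M' N' : Type*} [L₁.Structure M'] [L₂.Structure N']

theorem realize_sumMap_iff_rects (φ : (disjointLanguage L₁ L₂).Formula (α ⊕ β)) (a : α → M)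
    (b : β → N) :
    φ.Realize (Sum.map a b) ↔
      (rects φ (Sum.elim (Sum.map Sum.inl Sum.inl) Fin.elim0 :
        (α ⊕ β) ⊕ Fin 0 → (α ⊕ Fin 0) ⊕ (β ⊕ Fin 0))).Realize a default b default := by
  rw [realize_rects, Formula.Realize]
  refine iff_of_eq (congrArg₂ _ ?_ (Subsingleton.elim _ _))
  ext (i | i) <;> rfl

variable {M' N' : Type*} [L₁.Structure M'] [L₂.Structure N']

/-- The type of a tuple of a disjoint union is determined by the types of its two parts. -/
theorem SameType.sumMap {a : α → M} {a' : α → M'} {b : β → N} {b' : β → N'}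
    (h₁ : SameType L₁ a a') (h₂ : SameType L₂ b b') :
    SameType (disjointLanguage L₁ L₂) (Sum.map a b) (Sum.map a' b') := by
  intro φ
  rw [realize_sumMap_iff_rects, realize_sumMap_iff_rects]
  refine exists_congr fun p => and_congr_right fun _ => and_congr ?_ ?_
  · exact h₁ p.1
  · exact h₂ p.2

theorem ElementarilyEquivalent.sum (h₁ : M ≅[L₁] M') (h₂ : N ≅[L₂] N') :
    (M ⊕ N) ≅[disjointLanguage L₁ L₂] (M' ⊕ N') :=
  ((h₁.sameType (Empty.elim : Empty → M) (Empty.elim : Empty → M')).sumMap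
    (h₂.sameType (Empty.elim : Empty → N) (Empty.elim : Empty → N'))).elementarilyEquivalent

/-- The sum of elementary embeddings, as an elementary embedding of disjoint unions. -/
def ElementaryEmbedding.sum (f : M ↪ₑ[L₁] M') (g : N ↪ₑ[L₂] N') :
    (M ⊕ N) ↪ₑ[disjointLanguage L₁ L₂] (M' ⊕ N') where
  toFun := Sum.map f g
  map_formula' n φ x := by
    have := ((f.sameType id).sumMap (g.sameType id)).comp x φ
    simpa using this.symm

end FefermanVaught

/-! ### Structures that live on a definable part of another structure -/

section Parts

universe u' v'

/-- Symbols of a language `K` that describe an `L`-structure on a part of a `K`-structure: relation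
symbols for the relations, for the graphs of the functions, and for the part itself. -/
structure PartSymbols (L : Language.{u, v}) (K : Language.{u', v'}) where
  /-- the symbol for a relation -/
  rel : ∀ {n : ℕ}, L.Relations n → K.Relations n
  /-- the symbol for the graph of a function -/
  graph : ∀ {n : ℕ}, L.Functions n → K.Relations (n + 1)
  /-- the symbol for the part -/
  part : K.Relations 1

variable {L : Language.{u, v}} {K : Language.{u', v'}}

/-- The map `i` identifies the `L`-structure `M` with the part of the `K`-structure `A` that the
symbols `D` describe. -/
structure IsPart (D : PartSymbols L K) {M A : Type*} [L.Structure M] [K.Structure A]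
    (i : M → A) : Prop where
  injective : Function.Injective i
  part_iff : ∀ x : Fin 1 → A, Structure.RelMap D.part x ↔ ∃ m, x 0 = i m
  rel_iff : ∀ {n : ℕ} (R : L.Relations n) (x : Fin n → A),
    Structure.RelMap (D.rel R) x ↔ ∃ a : Fin n → M, (∀ j, x j = i (a j)) ∧ Structure.RelMap R a
  graph_iff : ∀ {n : ℕ} (f : L.Functions n) (x : Fin (n + 1) → A),
    Structure.RelMap (D.graph f) x ↔ ∃ a : Fin n → M, (∀ j : Fin n, x j.castSucc = i (a j)) ∧
      x (Fin.last n) = i (Structure.funMap f a)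

namespace PartSymbols

variable (D : PartSymbols L K)

/-- The graph of a term, as a `K`-formula. -/
noncomputable def termGraph {X : Type*} : L.Term X → K.Formula (X ⊕ Unit)
  | .var x => Term.equal (Term.var (Sum.inr ())) (Term.var (Sum.inl x))
  | .func (l := n) f ts => Formula.iExs (α := X ⊕ Unit) (Fin n)
      ((Formula.iInf fun j => (termGraph (ts j)).relabel
          (Sum.elim (Sum.inl ∘ Sum.inl) fun _ => Sum.inr j)) ⊓
        (D.graph f).formula fun j => Term.var
          (Fin.snoc (α := fun _ => (X ⊕ Unit) ⊕ Fin n) Sum.inr (Sum.inl (Sum.inr ())) j))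

/-- The translation of an `L`-formula to a `K`-formula. Its bound variables that are still open
become free variables. -/
noncomputable def translate {α : Type*} : ∀ {n : ℕ}, L.BoundedFormula α n → K.Formula (α ⊕ Fin n)
  | _, .falsum => ⊥
  | _, .equal t₁ t₂ => Formula.iExs Unit (D.termGraph t₁ ⊓ D.termGraph t₂)
  | _, .rel (l := l) R ts => Formula.iExs (Fin l)
      ((Formula.iInf fun j => (D.termGraph (ts j)).relabel (Sum.map id fun _ => j)) ⊓
        (D.rel R).formula fun j => Term.var (Sum.inr j))
  | _, .imp φ ψ => (translate φ).imp (translate ψ)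
  | n, .all φ => Formula.iAlls Unit
      (((D.part).formula fun _ => Term.var (Sum.inr ())).imp ((translate φ).relabel
        (Sum.elim (Sum.inl ∘ Sum.inl) (Fin.snoc (α := fun _ => (α ⊕ Fin n) ⊕ Unit)
          (Sum.inl ∘ Sum.inr) (Sum.inr ())))))

end PartSymbols

variable {D : PartSymbols L K} {M A : Type*} [L.Structure M] [K.Structure A] {i : M → A}

theorem Relations.realize_formula {β : Type*} {n : ℕ} (R : K.Relations n) (ts : Fin n → K.Term β)
    (v : β → A) : (R.formula ts).Realize v ↔ Structure.RelMap R fun j => (ts j).realize v :=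
  Formula.realize_rel

theorem IsPart.realize_termGraph (h : IsPart D i) {X : Type*} (t : L.Term X) (v : X → M)
    (y : Unit → A) :
    (D.termGraph t).Realize (Sum.elim (i ∘ v) y) ↔ y () = i (t.realize v) := by
  induction t generalizing y with
  | var x => simp [PartSymbols.termGraph, Formula.realize_equal]
  | @func n f ts ih =>
    simp only [PartSymbols.termGraph, Formula.realize_iExs, Formula.realize_inf,
      Formula.realize_iInf, Formula.realize_relabel, Relations.realize_formula, Term.realize_var,
      Term.realize_func]
    have e : ∀ (z : Fin n → A) (j : Fin n), Sum.elim (Sum.elim (i ∘ v) y) z ∘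
        Sum.elim (Sum.inl ∘ Sum.inl) (fun _ : Unit => Sum.inr j) =
          Sum.elim (i ∘ v) fun _ => z j := by
      intro z j; ext (_ | _) <;> rfl
    simp only [e, ih, h.graph_iff, Fin.snoc_castSucc, Fin.snoc_last, Sum.elim_inr, Sum.elim_inl]
    constructor
    · rintro ⟨z, hz, a, ha, hy⟩
      rw [hy]
      congr 2
      exact funext fun j => h.injective ((ha j).symm.trans (hz j))
    · intro hy
      exact ⟨fun j => i ((ts j).realize v), fun j => rfl, _, fun j => rfl, hy⟩

theorem IsPart.realize_translate (h : IsPart D i) {α : Type*} {n : ℕ} (φ : L.BoundedFormula α n)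
    (v : α → M) (xs : Fin n → M) :
    (D.translate φ).Realize (i ∘ Sum.elim v xs) ↔ φ.Realize v xs := by
  induction φ with
  | falsum => exact Iff.rfl
  | equal t₁ t₂ =>
    simp only [PartSymbols.translate, Formula.realize_iExs, Formula.realize_inf,
      h.realize_termGraph, BoundedFormula.Realize]
    constructor
    · rintro ⟨y, h1, h2⟩
      exact h.injective (h1.symm.trans h2)
    · intro h'
      exact ⟨fun _ => i (t₁.realize (Sum.elim v xs)), rfl, by rw [h']⟩
  | @rel n l R ts =>
    simp only [PartSymbols.translate, Formula.realize_iExs, Formula.realize_inf,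
      Formula.realize_iInf, Formula.realize_relabel, Relations.realize_formula, Term.realize_var,
      BoundedFormula.Realize, Sum.elim_inr, h.rel_iff]
    have e : ∀ (z : Fin l → A) (j : Fin l), Sum.elim (i ∘ Sum.elim v xs) z ∘
        Sum.map id (fun _ : Unit => j) = Sum.elim (i ∘ Sum.elim v xs) fun _ => z j := by
      intro z j; ext (_ | _) <;> rfl
    simp only [e, h.realize_termGraph]
    constructor
    · rintro ⟨z, hz, a, ha, hR⟩
      convert hR using 1
      exact funext fun j => h.injective ((hz j).symm.trans (ha j))
    · intro hR
      exact ⟨_, fun j => rfl, _, fun j => rfl, hR⟩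
  | imp φ ψ ih₁ ih₂ =>
    simp only [PartSymbols.translate, Formula.realize_imp, ih₁, ih₂, BoundedFormula.realize_imp]
  | @all n φ ih =>
    simp only [PartSymbols.translate, Formula.realize_iAlls, Formula.realize_imp,
      Formula.realize_relabel, Relations.realize_formula, Term.realize_var, Sum.elim_inr,
      BoundedFormula.realize_all, h.part_iff]
    have e : ∀ x : M, Sum.elim (i ∘ Sum.elim v xs) (fun _ : Unit => i x) ∘
        Sum.elim (Sum.inl ∘ Sum.inl) (Fin.snoc (α := fun _ => (α ⊕ Fin n) ⊕ Unit)
          (Sum.inl ∘ Sum.inr) (Sum.inr ())) =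
        i ∘ Sum.elim v (Fin.snoc xs x : Fin (n + 1) → M) := by
      intro x
      ext (j | j)
      · rfl
      · refine Fin.lastCases ?_ (fun k => ?_) j <;> simp
    constructor
    · intro h' x
      rw [← ih, ← e]
      exact h' _ ⟨x, rfl⟩
    · rintro h' y ⟨x, hx⟩
      obtain rfl : y = fun _ => i x := funext fun _ => hx
      rw [e, ih]
      exact h' x

variable {M' A' : Type*} [L.Structure M'] [K.Structure A'] {i' : M' → A'}

theorem comp_elim_id_elim0 {α X : Type*} (b : α → X) :
    b ∘ (Sum.elim id Fin.elim0 : α ⊕ Fin 0 → α) = Sum.elim b default := by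
  ext (j | j)
  · rfl
  · exact j.elim0

/-- The type of a tuple in a part is determined by its type in the whole structure. -/
theorem IsPart.sameType (h : IsPart D i) (h' : IsPart D i') {α : Type*} {a : α → M} {a' : α → M'}
    (ha : SameType K (i ∘ a) (i' ∘ a')) : SameType L a a' := by
  intro φ
  have := ha.comp (Sum.elim id Fin.elim0 : α ⊕ Fin 0 → α) (D.translate φ)
  rwa [Function.comp_assoc, Function.comp_assoc, comp_elim_id_elim0, comp_elim_id_elim0,
    h.realize_translate, h'.realize_translate] at this

theorem IsPart.elementarilyEquivalent (h : IsPart D i) (h' : IsPart D i') (hA : A ≅[K] A') :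
    M ≅[L] M' :=
  (h.sameType h' (hA.sameType (i ∘ (Empty.elim : Empty → M))
    (i' ∘ Empty.elim))).elementarilyEquivalent

theorem IsPart.part_apply (h : IsPart D i) (m : M) : Structure.RelMap D.part fun _ => i m :=
  (h.part_iff _).2 ⟨m, rfl⟩

theorem SameType.relMap_part_iff {α : Type*} {a : α → A} {a' : α → A'} (ha : SameType K a a')
    (j : α) : (Structure.RelMap D.part fun _ => a j) ↔ Structure.RelMap D.part fun _ => a' j := by
  simpa only [Relations.realize_formula, Term.realize_var] using
    ha (D.part.formula fun _ => Term.var j)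

/-- An elementary embedding of structures restricts to their parts. -/
theorem IsPart.exists_elementaryEmbedding (h : IsPart D i) (h' : IsPart D i') (f : A ↪ₑ[K] A') :
    ∃ g : M ↪ₑ[L] M', ∀ m, i' (g m) = f (i m) := by
  have : ∀ m, ∃ m', f (i m) = i' m' := fun m =>
    (h'.part_iff fun _ => f (i m)).1 ((f.map_rel D.part fun _ => i m).2 (h.part_apply m))
  choose g hg using this
  refine ⟨⟨g, fun n φ x => ?_⟩, fun m => (hg m).symm⟩
  refine (h.sameType h' (a := x) (a' := g ∘ x) ?_ φ).symm
  have := f.sameType (i ∘ x)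
  convert this using 1
  exact funext fun j => (hg _).symm

/-- An isomorphism of structures restricts to their parts. -/
theorem IsPart.nonempty_equiv (h : IsPart D i) (h' : IsPart D i') (f : A ≃[K] A') :
    Nonempty (M ≃[L] M') := by
  obtain ⟨g, hg⟩ := h.exists_elementaryEmbedding h' f.toElementaryEmbedding
  obtain ⟨g', hg'⟩ := h'.exists_elementaryEmbedding h f.symm.toElementaryEmbedding
  refine ⟨⟨⟨g, g', fun m => h.injective ?_, fun m => h'.injective ?_⟩, g.map_fun, g.map_rel⟩⟩
  · rw [hg', hg]; exact f.symm_apply_apply _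
  · rw [hg, hg']; exact f.apply_symm_apply _

/-- The variables of a formula about `n` given elements and one more element `b`. -/
def snocVar {β : Type*} (n : ℕ) (b : β) : Fin (n + 1) → Fin n ⊕ β :=
  Fin.snoc (α := fun _ => Fin n ⊕ β) Sum.inl (Sum.inr b)

/-- The formula stating a relation between `n` given elements and one more element `b`. -/
def Relations.snocFormula {β : Type*} {n : ℕ} (R : K.Relations (n + 1)) (b : β) :
    K.Formula (Fin n ⊕ β) :=
  R.formula fun j => Term.var (snocVar n b j)

theorem Relations.realize_snocFormula {β : Type*} {n : ℕ} (R : K.Relations (n + 1)) (b : β)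
    (v : Fin n ⊕ β → A) : (R.snocFormula b).Realize v ↔
      Structure.RelMap R (Fin.snoc (v ∘ Sum.inl) (v (Sum.inr b)) : Fin (n + 1) → A) := by
  rw [snocFormula, Relations.realize_formula]
  refine iff_of_eq (congrArg _ (funext fun j => ?_))
  refine Fin.lastCases ?_ (fun j => ?_) j <;> simp [snocVar]

/-- A structure elementarily equivalent to one with a part has a part itself. -/
theorem IsPart.exists_of_elementarilyEquivalent {B : Type w₁} [K.Structure B] (h : IsPart D i)
    (hB : A ≅[K] B) :
    ∃ _ : L.Structure {y : B // Structure.RelMap D.part fun _ => y},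
      IsPart D (Subtype.val : {y : B // Structure.RelMap D.part fun _ => y} → B) := by
  classical
  have hr : ∀ {n} (R : L.Relations n) (x : Fin n → B), Structure.RelMap (D.rel R) x →
      ∀ j, Structure.RelMap D.part fun _ => x j := by
    intro n R x hx j
    have := (hB.forall_realize (((D.rel R).formula fun j => Term.var j).imp
      (D.part.formula fun _ => Term.var j))).1 (by
        simp only [Formula.realize_imp, Relations.realize_formula, Term.realize_var]
        intro x hx
        obtain ⟨a, ha, -⟩ := (h.rel_iff R x).1 hx
        rw [ha]
        exact h.part_apply _) x
    simp only [Formula.realize_imp, Relations.realize_formula, Term.realize_var] at this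
    exact this hx
  have hg : ∀ {n} (f : L.Functions n) (x : Fin (n + 1) → B), Structure.RelMap (D.graph f) x →
      ∀ j, Structure.RelMap D.part fun _ => x j := by
    intro n f x hx j
    have := (hB.forall_realize (((D.graph f).formula fun j => Term.var j).imp
      (D.part.formula fun _ => Term.var j))).1 (by
        simp only [Formula.realize_imp, Relations.realize_formula, Term.realize_var]
        intro x hx
        obtain ⟨a, ha, ha'⟩ := (h.graph_iff f x).1 hx
        refine Fin.lastCases ?_ (fun j => ?_) j
        · rw [ha']; exact h.part_apply _
        · rw [ha]; exact h.part_apply _) x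
    simp only [Formula.realize_imp, Relations.realize_formula, Term.realize_var] at this
    exact this hx
  have hu : ∀ {n} (f : L.Functions n) (x : Fin n → B) (y y' : B),
      Structure.RelMap (D.graph f) (Fin.snoc x y : Fin (n + 1) → B) →
      Structure.RelMap (D.graph f) (Fin.snoc x y' : Fin (n + 1) → B) → y = y' := by
    intro n f x y y' hy hy'
    have := (hB.forall_realize (((D.graph f).snocFormula true).imp
      (((D.graph f).snocFormula false).imp
        (Term.equal (Term.var (Sum.inr true)) (Term.var (Sum.inr false)))))).1 (by
        simp only [Formula.realize_imp, Term.realize_var,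
          Formula.realize_equal, Relations.realize_snocFormula, h.graph_iff, Fin.snoc_castSucc, Fin.snoc_last]
        rintro v ⟨a, ha, h1⟩ ⟨a', ha', h2⟩
        rw [h1, h2, show a = a' from funext fun j => h.injective ((ha j).symm.trans (ha' j))])
      (Sum.elim x fun b => if b then y else y')
    simp only [Formula.realize_imp, Term.realize_var,
      Formula.realize_equal, Relations.realize_snocFormula] at this
    simpa using this (by simpa using hy) (by simpa using hy')
  have he : ∀ {n} (f : L.Functions n) (x : Fin n → B), (∀ j, Structure.RelMap D.part fun _ => x j) →
      ∃ y, Structure.RelMap (D.graph f) (Fin.snoc x y : Fin (n + 1) → B) := by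
    intro n f x hx
    have := (hB.forall_realize ((Formula.iInf fun j : Fin n => D.part.formula fun _ =>
      Term.var j).imp (Formula.iExs Unit ((D.graph f).snocFormula ())))).1 (by
        simp only [Formula.realize_imp, Relations.realize_formula, Term.realize_var,
          Formula.realize_iInf, Formula.realize_iExs, Relations.realize_snocFormula, h.graph_iff, h.part_iff,
          Fin.snoc_castSucc, Fin.snoc_last]
        intro v hv
        choose a ha using hv
        exact ⟨fun _ => i (Structure.funMap f a), a, ha, rfl⟩) x
    simp only [Formula.realize_imp, Relations.realize_formula, Term.realize_var,
      Formula.realize_iInf, Formula.realize_iExs, Relations.realize_snocFormula] at this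
    obtain ⟨y, hy⟩ := this hx
    exact ⟨y (), hy⟩
  choose F hF using fun (n : ℕ) (f : L.Functions n)
    (a : Fin n → {y : B // Structure.RelMap D.part fun _ => y}) =>
      he f (fun j => a j) fun j => (a j).2
  let S : L.Structure {y : B // Structure.RelMap D.part fun _ => y} :=
    { funMap := fun {n} f a => ⟨F n f a, by
        simpa using hg f _ (hF n f a) (Fin.last n)⟩
      RelMap := fun R a => Structure.RelMap (D.rel R) fun j => (a j : B) }
  refine ⟨S, Subtype.val_injective, fun x => ?_, fun R x => ?_, fun {n} f x => ?_⟩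
  · have : x = fun _ => x 0 := funext fun j => by rw [Subsingleton.elim j 0]
    constructor
    · intro hx
      exact ⟨⟨x 0, this ▸ hx⟩, rfl⟩
    · rintro ⟨m, hm⟩
      rw [this, hm]
      exact m.2
  · constructor
    · intro hx
      exact ⟨fun j => ⟨x j, hr R x hx j⟩, fun j => rfl, hx⟩
    · rintro ⟨a, ha, hR⟩
      rw [show x = fun j => (a j : B) from funext ha]
      exact hR
  · constructor
    · intro hx
      refine ⟨fun j => ⟨x j.castSucc, hg f x hx _⟩, fun j => rfl, ?_⟩
      refine hu f (fun j => x j.castSucc) _ _ ?_ (hF n f fun j => ⟨x j.castSucc, hg f x hx _⟩)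
      rwa [show (Fin.snoc (fun j => x j.castSucc) (x (Fin.last n)) : Fin (n + 1) → B) = x from
        Fin.snoc_init_self x]
    · rintro ⟨a, ha, hl⟩
      have := hF n f a
      convert this
      rw [← show (Fin.snoc (fun j => x j.castSucc) (x (Fin.last n)) : Fin (n + 1) → B) = x from
        Fin.snoc_init_self x, hl]
      congr 1
      exact funext ha

end Parts

/-! ### Models of the theory of a disjoint union -/

section SumParts

variable {L₁ : Language.{u₁, v₁}} {L₂ : Language.{u₂, v₂}}

/-- The symbols that describe the left part of a disjoint union. -/
def leftSymbols (L₁ : Language.{u₁, v₁}) (L₂ : Language.{u₂, v₂}) :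
    PartSymbols L₁ (disjointLanguage L₁ L₂) :=
  ⟨DisjointRel.relLeft, DisjointRel.graphLeft, DisjointRel.partLeft⟩

/-- The symbols that describe the right part of a disjoint union. -/
def rightSymbols (L₁ : Language.{u₁, v₁}) (L₂ : Language.{u₂, v₂}) :
    PartSymbols L₂ (disjointLanguage L₁ L₂) :=
  ⟨DisjointRel.relRight, DisjointRel.graphRight, DisjointRel.partRight⟩

theorem isPart_inl (M N : Type*) [L₁.Structure M] [L₂.Structure N] :
    IsPart (leftSymbols L₁ L₂) (Sum.inl : M → M ⊕ N) :=
  ⟨Sum.inl_injective, fun _ => Iff.rfl, fun _ _ => Iff.rfl, fun _ _ => Iff.rfl⟩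

theorem isPart_inr (M N : Type*) [L₁.Structure M] [L₂.Structure N] :
    IsPart (rightSymbols L₁ L₂) (Sum.inr : N → M ⊕ N) :=
  ⟨Sum.inr_injective, fun _ => Iff.rfl, fun _ _ => Iff.rfl, fun _ _ => Iff.rfl⟩

/-- A structure that is the union of its two disjoint parts is isomorphic to their disjoint
union. -/
theorem nonempty_equiv_sum {M N A : Type*} [L₁.Structure M] [L₂.Structure N]
    [(disjointLanguage L₁ L₂).Structure A] {i : M → A} {j : N → A}
    (hi : IsPart (leftSymbols L₁ L₂) i) (hj : IsPart (rightSymbols L₁ L₂) j)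
    (hd : ∀ m n, i m ≠ j n) (hc : ∀ y, (∃ m, y = i m) ∨ ∃ n, y = j n) :
    Nonempty ((M ⊕ N) ≃[disjointLanguage L₁ L₂] A) := by
  have hb : Function.Bijective (Sum.elim i j) := by
    refine ⟨hi.injective.sumElim hj.injective hd, fun y => ?_⟩
    rcases hc y with ⟨m, rfl⟩ | ⟨n, rfl⟩
    · exact ⟨Sum.inl m, rfl⟩
    · exact ⟨Sum.inr n, rfl⟩
  have hl : ∀ (y : M ⊕ N) m, Sum.elim i j y = i m ↔ y = Sum.inl m := fun y m =>
    (hb.1.eq_iff (b := Sum.inl m))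
  have hr : ∀ (y : M ⊕ N) n, Sum.elim i j y = j n ↔ y = Sum.inr n := fun y n =>
    (hb.1.eq_iff (b := Sum.inr n))
  refine ⟨⟨_root_.Equiv.ofBijective _ hb, fun f => Empty.elim f, fun {n} R x => ?_⟩⟩
  change Structure.RelMap R (Sum.elim i j ∘ x) ↔ _
  cases R with
  | relLeft R =>
    refine (hi.rel_iff R _).trans ?_
    simp only [Function.comp_apply, hl]
    rfl
  | relRight R =>
    refine (hj.rel_iff R _).trans ?_
    simp only [Function.comp_apply, hr]
    rfl
  | graphLeft f =>
    refine (hi.graph_iff f _).trans ?_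
    simp only [Function.comp_apply, hl]
    rfl
  | graphRight f =>
    refine (hj.graph_iff f _).trans ?_
    simp only [Function.comp_apply, hr]
    rfl
  | partLeft =>
    refine (hi.part_iff _).trans ?_
    simp only [Function.comp_apply, hl]
    rfl
  | partRight =>
    refine (hj.part_iff _).trans ?_
    simp only [Function.comp_apply, hr]
    rfl

/-- A structure elementarily equivalent to a disjoint union is isomorphic to a disjoint union of
structures elementarily equivalent to the given ones. -/
theorem exists_sum_equiv {M : Type*} {N : Type*} {A : Type w₁} [L₁.Structure M] [L₂.Structure N]
    [(disjointLanguage L₁ L₂).Structure A] (hA : (M ⊕ N) ≅[disjointLanguage L₁ L₂] A) :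
    ∃ (M' N' : Type w₁) (_ : L₁.Structure M') (_ : L₂.Structure N'),
      (M ≅[L₁] M') ∧ (N ≅[L₂] N') ∧ Nonempty ((M' ⊕ N') ≃[disjointLanguage L₁ L₂] A) := by
  obtain ⟨S₁, h₁⟩ := (isPart_inl M N).exists_of_elementarilyEquivalent hA
  obtain ⟨S₂, h₂⟩ := (isPart_inr M N).exists_of_elementarilyEquivalent hA
  have cover := (hA.forall_realize
    (((leftSymbols L₁ L₂).part.formula fun _ => Term.var ()) ⊔
      ((rightSymbols L₁ L₂).part.formula fun _ => Term.var ()))).1 (by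
    simp only [Formula.realize_sup, Relations.realize_formula, Term.realize_var,
      (isPart_inl M N).part_iff, (isPart_inr M N).part_iff]
    intro v
    rcases v () with m | n <;> simp)
  have disj := (hA.forall_realize
    (((leftSymbols L₁ L₂).part.formula fun _ => Term.var ()) ⊓
      ((rightSymbols L₁ L₂).part.formula fun _ => Term.var ())).not).1 (by
    simp only [Formula.realize_not, Formula.realize_inf, Relations.realize_formula,
      Term.realize_var, (isPart_inl M N).part_iff, (isPart_inr M N).part_iff]
    intro v
    rcases v () with m | n <;> simp)
  simp only [Formula.realize_sup, Formula.realize_not, Formula.realize_inf,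
    Relations.realize_formula, Term.realize_var] at cover disj
  refine ⟨_, _, S₁, S₂, (isPart_inl M N).elementarilyEquivalent h₁ hA,
    (isPart_inr M N).elementarilyEquivalent h₂ hA, nonempty_equiv_sum h₁ h₂ ?_ ?_⟩
  · intro m n h
    exact disj (fun _ => m.1) ⟨m.2, h ▸ n.2⟩
  · intro y
    rcases cover fun _ => y with h | h
    · exact Or.inl ⟨⟨y, h⟩, rfl⟩
    · exact Or.inr ⟨⟨y, h⟩, rfl⟩

end SumParts

/-! ### Lattices, Boolean algebras and linear orders that are products -/

section ProductOrders

variable {α β γ : Type*}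

theorem IsLatticeOrdered.of_orderIso [Lattice β] [Preorder α] (e : α ≃o β) :
    IsLatticeOrdered α :=
  ⟨e.toEquiv.lattice, fun _ _ => e.le_iff_le⟩

theorem IsLatticeOrdered.of_orderIso_prod [Lattice γ] [p : Preorder α] [Preorder β] [Nonempty β]
    (e : γ ≃o α × β) : IsLatticeOrdered α := by
  obtain ⟨b⟩ := ‹Nonempty β›
  let j : α → γ := fun a => e.symm (a, b)
  have hj : ∀ {x y}, j x ≤ j y ↔ x ≤ y := by
    intro x y
    simp [j, Prod.mk_le_mk]
  -- The first coordinate of a bound of elements of the fibre over `b` is a bound in `α`.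
  have h1 : ∀ {x : α} {c : γ}, j x ≤ c → x ≤ (e c).1 := fun h => (e.symm_apply_le.1 h).1
  have h2 : ∀ {x : α} {c : γ}, c ≤ j x → (e c).1 ≤ x := fun h => (e.le_symm_apply.1 h).1
  exact ⟨{ p with
      le_antisymm x y h h' := by
        have := e.symm.injective (le_antisymm (hj.2 h) (hj.2 h'))
        exact congrArg Prod.fst this
      sup x y := (e (j x ⊔ j y)).1
      inf x y := (e (j x ⊓ j y)).1
      le_sup_left x y := h1 le_sup_left
      le_sup_right x y := h1 le_sup_right
      sup_le x y z h h' := h2 (sup_le (hj.2 h) (hj.2 h'))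
      inf_le_left x y := h2 inf_le_left
      inf_le_right x y := h2 inf_le_right
      le_inf x y z h h' := h1 (le_inf (hj.2 h) (hj.2 h')) }, fun _ _ => Iff.rfl⟩

theorem IsBooleanOrdered.of_orderIso [BooleanAlgebra β] [Preorder α] (e : α ≃o β) :
    IsBooleanOrdered α :=
  ⟨e.toEquiv.booleanAlgebra, fun _ _ => e.le_iff_le⟩

/-- A factor of a Boolean algebra is isomorphic to the interval above the pair of the least element
of this factor and the greatest element of the other one. -/
theorem IsBooleanOrdered.of_orderIso_prod [BooleanAlgebra γ] [Preorder α] [Preorder β]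
    (e : γ ≃o α × β) : IsBooleanOrdered α := by
  have hanti : ∀ {x y : α × β}, x ≤ y → y ≤ x → x = y := fun h h' =>
    e.symm.injective (le_antisymm (e.symm.monotone h) (e.symm.monotone h'))
  let t : α × β := e ⊤
  have ht : ∀ x, x ≤ t := fun x => e.symm_apply_le.1 le_top
  let z : α × β := e ⊥
  have hz : ∀ x, z ≤ x := fun x => e.le_symm_apply.1 bot_le
  let c : γ := e.symm (z.1, t.2)
  let i : α ≃o Set.Ici c :=
    { toFun := fun a => ⟨e.symm (a, t.2), e.symm.monotone ⟨(hz (a, t.2)).1, le_rfl⟩⟩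
      invFun := fun x => (e x).1
      left_inv := fun a => by simp
      right_inv := fun x => by
        refine Subtype.ext (e.symm_apply_eq.2 (hanti ⟨le_rfl, ?_⟩ ⟨le_rfl, ?_⟩))
        · exact (e.symm_apply_le.1 (show c ≤ x from x.2)).2
        · exact (ht (e x)).2
      map_rel_iff' := by
        intro a b
        change e.symm (a, t.2) ≤ e.symm (b, t.2) ↔ a ≤ b
        simp [Prod.mk_le_mk] }
  let _ : BooleanAlgebra (Set.Ici c) := DistribLattice.booleanAlgebraOfComplemented _
  exact IsBooleanOrdered.of_orderIso i

theorem isLinearlyOrdered_iff [p : Preorder α] :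
    IsLinearlyOrdered α ↔ (∀ a b : α, a ≤ b → b ≤ a → a = b) ∧ ∀ a b : α, a ≤ b ∨ b ≤ a := by
  classical
  constructor
  · rintro ⟨l, hl⟩
    exact ⟨fun a b h h' => l.le_antisymm a b ((hl _ _).2 h) ((hl _ _).2 h'), fun a b =>
      (l.le_total a b).imp (hl _ _).1 (hl _ _).1⟩
  · rintro ⟨h, h'⟩
    exact ⟨{ p with
      le_antisymm := h
      le_total := h'
      toDecidableLE := Classical.decRel _ }, fun _ _ => Iff.rfl⟩

theorem isLatticeOrdered_iff_of_orderIso_prod [pα : Preorder α] [pβ : Preorder β]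
    [pγ : Preorder γ] [Nonempty α] [Nonempty β] (e : γ ≃o α × β) :
    IsLatticeOrdered γ ↔ IsLatticeOrdered α ∧ IsLatticeOrdered β := by
  constructor
  · rintro ⟨l, hl⟩
    obtain rfl : l.toPreorder = pγ := Preorder.ext hl
    exact ⟨.of_orderIso_prod e, .of_orderIso_prod (e.trans OrderIso.prodComm)⟩
  · rintro ⟨⟨l, hl⟩, l', hl'⟩
    obtain rfl : l.toPreorder = pα := Preorder.ext hl
    obtain rfl : l'.toPreorder = pβ := Preorder.ext hl'
    exact .of_orderIso e

theorem isBooleanOrdered_iff_of_orderIso_prod [pα : Preorder α] [pβ : Preorder β]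
    [pγ : Preorder γ] (e : γ ≃o α × β) :
    IsBooleanOrdered γ ↔ IsBooleanOrdered α ∧ IsBooleanOrdered β := by
  constructor
  · rintro ⟨l, hl⟩
    obtain rfl : l.toPreorder = pγ := Preorder.ext hl
    exact ⟨.of_orderIso_prod e, .of_orderIso_prod (e.trans OrderIso.prodComm)⟩
  · rintro ⟨⟨l, hl⟩, l', hl'⟩
    obtain rfl : l.toPreorder = pα := Preorder.ext hl
    obtain rfl : l'.toPreorder = pβ := Preorder.ext hl'
    exact .of_orderIso e

/-- A product of two nonempty orders is linear only if one of them is trivial: pairs that are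
strictly increasing in opposite coordinates are incomparable. -/
theorem isLinearlyOrdered_iff_of_orderIso_prod [Preorder α] [Preorder β] [Preorder γ] [Nonempty α]
    [Nonempty β] (e : γ ≃o α × β) :
    IsLinearlyOrdered γ ↔ IsLinearlyOrdered α ∧ IsLinearlyOrdered β ∧
      (Subsingleton α ∨ Subsingleton β) := by
  simp only [isLinearlyOrdered_iff]
  obtain ⟨a₀⟩ := ‹Nonempty α›
  obtain ⟨b₀⟩ := ‹Nonempty β›
  constructor
  · rintro ⟨h, h'⟩
    have k : ∀ x y : α × β, x ≤ y → y ≤ x → x = y := fun x y hx hy =>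
      e.symm.injective (h _ _ (e.symm.monotone hx) (e.symm.monotone hy))
    have k' : ∀ x y : α × β, x ≤ y ∨ y ≤ x := fun x y =>
      (h' (e.symm x) (e.symm y)).imp e.symm.le_iff_le.1 e.symm.le_iff_le.1
    have ha : ∀ a b : α, a ≤ b → b ≤ a → a = b := fun a b hab hba =>
      congrArg Prod.fst (k (a, b₀) (b, b₀) ⟨hab, le_rfl⟩ ⟨hba, le_rfl⟩)
    have hb : ∀ a b : β, a ≤ b → b ≤ a → a = b := fun a b hab hba =>
      congrArg Prod.snd (k (a₀, a) (a₀, b) ⟨le_rfl, hab⟩ ⟨le_rfl, hba⟩)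
    have ta : ∀ a b : α, a ≤ b ∨ b ≤ a := fun a b =>
      (k' (a, b₀) (b, b₀)).imp And.left And.left
    have tb : ∀ a b : β, a ≤ b ∨ b ≤ a := fun a b =>
      (k' (a₀, a) (a₀, b)).imp And.right And.right
    refine ⟨⟨ha, ta⟩, ⟨hb, tb⟩, ?_⟩
    by_contra! hc
    obtain ⟨⟨a, a', hne⟩, ⟨b, b', hne'⟩⟩ :=
      And.intro hc.1.exists_pair_ne hc.2.exists_pair_ne
    wlog hab : a ≤ a' generalizing a a'
    · exact this a' a hne.symm ((ta a a').resolve_left hab)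
    wlog hbb : b ≤ b' generalizing b b'
    · exact this b' b hne'.symm ((tb b b').resolve_left hbb)
    rcases k' (a, b') (a', b) with h | h
    · exact hne' (hb _ _ hbb h.2)
    · exact hne (ha _ _ hab h.1)
  · rintro ⟨⟨ha, ta⟩, ⟨hb, tb⟩, hs⟩
    refine ⟨fun x y h h' => e.injective (Prod.ext (ha _ _ ?_ ?_) (hb _ _ ?_ ?_)), fun x y => ?_⟩
    · exact (e.monotone h).1
    · exact (e.monotone h').1
    · exact (e.monotone h).2
    · exact (e.monotone h').2
    · rw [← e.le_iff_le, ← e.le_iff_le (x := y)]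
      rcases hs with hs | hs
      · exact (tb (e x).2 (e y).2).imp (fun h => ⟨(Subsingleton.elim _ _).le, h⟩)
          fun h => ⟨(Subsingleton.elim _ _).le, h⟩
      · exact (ta (e x).1 (e y).1).imp (fun h => ⟨h, (Subsingleton.elim _ _).le⟩)
          fun h => ⟨h, (Subsingleton.elim _ _).le⟩

end ProductOrders

/-! ### The isomorphism types of prime models of a complete theory -/

section LRK

variable {L : Language.{u, v}} {T : L.Theory}

theorem Theory.IsComplete.elementarilyEquivalent (hT : T.IsComplete) (M : Type w₁) (N : Type w₂)
    [L.Structure M] [L.Structure N] [M ⊨ T] [N ⊨ T] [Nonempty M] [Nonempty N] : M ≅[L] N :=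
  (hT.eq_complete_theory M).symm.trans (hT.eq_complete_theory N)

instance (M : CountableModel T) : Countable M.1 := M.2

/-- The isomorphism type of a model that is prime over a finite tuple. -/
def LRK.mk (M : CountableModel T) (hM : IsPrimeOverFinite L M.1) : LRK T :=
  ⟨Quotient.mk _ M, M, rfl, hM⟩

/-- A chosen model of a given isomorphism type. -/
noncomputable def LRK.rep (c : LRK T) : CountableModel T := c.2.choose

theorem LRK.mk_rep (c : LRK T) : Quotient.mk (countableModelSetoid T) c.rep = c.1 :=
  c.2.choose_spec.1

theorem LRK.isPrimeOverFinite_rep (c : LRK T) : IsPrimeOverFinite L c.rep.1 := c.2.choose_spec.2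

theorem LRK.eq_iff {c d : LRK T} : c = d ↔ Nonempty (c.rep.1 ≃[L] d.rep.1) :=
  ⟨fun h => Quotient.exact (c.mk_rep.trans ((congrArg Subtype.val h).trans d.mk_rep.symm)),
    fun h => Subtype.ext (c.mk_rep.symm.trans ((Quotient.sound h).trans d.mk_rep))⟩

theorem LRK.eq_mk_iff {c : LRK T} {M : CountableModel T} {hM : IsPrimeOverFinite L M.1} :
    c = LRK.mk M hM ↔ Nonempty (c.rep.1 ≃[L] M.1) :=
  ⟨fun h => Quotient.exact (c.mk_rep.trans (congrArg Subtype.val h)),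
    fun h => Subtype.ext (c.mk_rep.symm.trans (Quotient.sound h))⟩

theorem LRK.le_iff {c d : LRK T} : c ≤ d ↔ Nonempty (c.rep.1 ↪ₑ[L] d.rep.1) := by
  constructor
  · rintro ⟨M, N, hM, hN, ⟨f⟩⟩
    obtain ⟨e⟩ : Nonempty (c.rep.1 ≃[L] M.1) := Quotient.exact (c.mk_rep.trans hM.symm)
    obtain ⟨e'⟩ : Nonempty (N.1 ≃[L] d.rep.1) := Quotient.exact (hN.trans d.mk_rep.symm)
    exact ⟨e'.toElementaryEmbedding.comp (f.comp e.toElementaryEmbedding)⟩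
  · exact fun h => ⟨_, _, c.mk_rep, d.mk_rep, h⟩

variable [Countable L.Symbols]

theorem nonempty_countableModel (hT : T.IsSatisfiable) : Nonempty (CountableModel T) := by
  obtain ⟨M⟩ := hT
  obtain ⟨E, -, hE⟩ := exists_countable_elementarySubstructure (L := L) (∅ : Set M)
    Set.countable_empty
  have : E ⊨ T := (E.theory_model_iff T).2 inferInstance
  have : Nonempty E := E.elementarilyEquivalent.nonempty_iff.2 inferInstance
  exact ⟨(exists_countableModel_equiv (T := T) E).choose⟩

/-- Every finite tuple of a model lies, up to isomorphism, in an elementary submodel that is atomic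
over it. -/
theorem exists_atomicOver_countableModel [Countable (CountableIsoType T)] (M : CountableModel T)
    {ι : Type} [Finite ι] (a : ι → M.1) :
    ∃ (N : CountableModel T) (f : N.1 ↪ₑ[L] M.1) (b : ι → N.1), f ∘ b = a ∧ AtomicOver L b := by
  obtain ⟨E, hE, b, hb, h⟩ := exists_atomicOver (T := T) a
  have : E ⊨ T := (E.theory_model_iff T).2 inferInstance
  have : Nonempty E := E.elementarilyEquivalent.nonempty_iff.2 inferInstance
  exact ⟨⟨Theory.ModelType.of T E, hE⟩, E.subtype, b, funext hb, h⟩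

theorem nonempty_LRK [Countable (CountableIsoType T)] (hT : T.IsSatisfiable) :
    Nonempty (LRK T) := by
  obtain ⟨M⟩ := nonempty_countableModel hT
  obtain ⟨N, -, b, -, hb⟩ := exists_atomicOver_countableModel M (Empty.elim : Empty → M.1)
  exact ⟨LRK.mk N hb.isPrimeOverFinite⟩

/-- If all models prime over finite tuples are isomorphic, then all countable models are. Indeed the
type of a tuple of a countable model is realized in a model prime over this tuple, hence in the
atomic model, and so it is isolated; thus all countable models are atomic. -/
theorem subsingleton_LRK_iff [Countable (CountableIsoType T)] (hT : T.IsComplete) :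
    Subsingleton (LRK T) ↔ Subsingleton (CountableIsoType T) := by
  refine ⟨fun hs => ?_, fun hs => inferInstanceAs (Subsingleton (Subtype _))⟩
  obtain ⟨M⟩ := nonempty_countableModel hT.1
  obtain ⟨M₀, -, b₀, -, h₀⟩ := exists_atomicOver_countableModel M (Empty.elim : Empty → M.1)
  have atomic : ∀ N : CountableModel T, AtomicOver L (Empty.elim : Empty → N.1) := by
    intro N n a
    obtain ⟨K, f, b, hb, h⟩ := exists_atomicOver_countableModel N a
    obtain ⟨e⟩ : Nonempty (K.1 ≃[L] M₀.1) := Quotient.exact (congrArg Subtype.val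
      (Subsingleton.elim (LRK.mk K h.isPrimeOverFinite) (LRK.mk M₀ h₀.isPrimeOverFinite)))
    have h' : AtomicOver L (Empty.elim : Empty → K.1) :=
      h₀.of_sameType e.toElementaryEmbedding (Subsingleton.elim _ _)
    refine (h' n b).of_sameType ?_
    have := f.sameType (Sum.elim (Empty.elim : Empty → K.1) b)
    rwa [Sum.comp_elim, hb, Subsingleton.elim (f ∘ Empty.elim) Empty.elim] at this
  refine ⟨fun c d => ?_⟩
  induction c using Quotient.inductionOn with | h N =>
  induction d using Quotient.inductionOn with | h N' =>
  exact Quotient.sound ((atomic N).nonempty_equiv (atomic N')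
    ((hT.elementarilyEquivalent N.1 N'.1).sameType _ _))

theorem numCountableModels_eq_one_iff [Countable (CountableIsoType T)] (hT : T.IsComplete) :
    numCountableModels T = 1 ↔ Subsingleton (LRK T) := by
  have : Nonempty (CountableIsoType T) := (nonempty_countableModel hT.1).map (Quotient.mk _)
  rw [subsingleton_LRK_iff hT, ← ENat.card_le_one_iff_subsingleton, numCountableModels]
  exact ⟨fun h => h.le, fun h => h.antisymm ((ENat.one_le_card_iff_nonempty _).2 this)⟩

end LRK

/-! ### Prime models of a disjoint union -/

section SumPrime

variable {L₁ : Language.{u₁, v₁}} {L₂ : Language.{u₂, v₂}} {M N : Type} [L₁.Structure M]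
  [L₂.Structure N]

theorem exists_sumMap_decomposition {α β : Type*} {n : ℕ} (c : Fin n → α ⊕ β) :
    ∃ (ι κ : Type) (_ : Finite ι) (_ : Finite κ) (e : ι ⊕ κ ≃ Fin n) (a : ι → α) (b : κ → β),
      c ∘ e = Sum.map a b := by
  classical
  have hl : ∀ i : {i // (c i).isLeft}, ∃ a, c i = Sum.inl a := fun i => Sum.isLeft_iff.1 i.2
  have hr : ∀ i : {i // ¬ (c i).isLeft}, ∃ b, c i = Sum.inr b := fun i =>
    Sum.isRight_iff.1 (by simpa using i.2)
  choose a ha using hl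
  choose b hb using hr
  refine ⟨_, _, inferInstance, inferInstance, Equiv.sumCompl fun i => ((c i).isLeft : Prop), a, b,
    ?_⟩
  ext (i | i)
  · simp [ha]
  · simp [hb]

/-- The factors of a disjoint union that is prime over a finite tuple are prime over the two parts
of this tuple. -/
theorem IsPrimeOverFinite.of_sum (h : IsPrimeOverFinite (disjointLanguage L₁ L₂) (M ⊕ N)) :
    IsPrimeOverFinite L₁ M ∧ IsPrimeOverFinite L₂ N := by
  obtain ⟨n, c, hc⟩ := h
  obtain ⟨ι, κ, _, _, e, a, b, he⟩ := exists_sumMap_decomposition c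
  have key : ∀ (A : Type) [(disjointLanguage L₁ L₂).Structure A] (d : ι ⊕ κ → A),
      SameType (disjointLanguage L₁ L₂) (Sum.map a b) d →
      ∃ f : (M ⊕ N) ↪ₑ[disjointLanguage L₁ L₂] A, ∀ i, f (Sum.map a b i) = d i := by
    intro A _ d hd
    obtain ⟨f, hf⟩ := hc A (d ∘ e.symm) (by
      have := SameType.comp (L := disjointLanguage L₁ L₂) hd e.symm
      rwa [← he, Function.comp_assoc, e.self_comp_symm, Function.comp_id] at this)
    refine ⟨f, fun i => ?_⟩
    rw [← he]
    simpa using hf (e i)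
  constructor
  · refine isPrimeOverFinite_of_finite a fun M' _ a' ha => ?_
    obtain ⟨f, hf⟩ := key (M' ⊕ N) (Sum.map a' b) (ha.sumMap fun _ => Iff.rfl)
    obtain ⟨g, hg⟩ := (isPart_inl M N).exists_elementaryEmbedding (isPart_inl M' N) f
    exact ⟨g, fun i => Sum.inl_injective ((hg (a i)).trans (hf (Sum.inl i)))⟩
  · refine isPrimeOverFinite_of_finite b fun N' _ b' hb => ?_
    obtain ⟨f, hf⟩ := key (M ⊕ N') (Sum.map a b')
      (SameType.sumMap (L₁ := L₁) (L₂ := L₂) (fun _ => Iff.rfl) hb)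
    obtain ⟨g, hg⟩ := (isPart_inr M N).exists_elementaryEmbedding (isPart_inr M N') f
    exact ⟨g, fun i => Sum.inr_injective ((hg (b i)).trans (hf (Sum.inr i)))⟩

/-- A disjoint union of structures that are prime over finite tuples is prime over the union of
these tuples. -/
theorem IsPrimeOverFinite.sum (hM : IsPrimeOverFinite L₁ M) (hN : IsPrimeOverFinite L₂ N) :
    IsPrimeOverFinite (disjointLanguage L₁ L₂) (M ⊕ N) := by
  obtain ⟨n, a, ha⟩ := hM
  obtain ⟨m, b, hb⟩ := hN
  refine isPrimeOverFinite_of_finite (Sum.map a b) fun A _ d hd => ?_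
  obtain ⟨M', N', _, _, -, -, ⟨e⟩⟩ := exists_sum_equiv hd.elementarilyEquivalent
  have hd' := hd.trans (e.symm.sameType d)
  have hl : ∀ i, ∃ a' : M', (e.symm ∘ d) (Sum.inl i) = Sum.inl a' := fun i =>
    (isPart_inl M' N').part_iff _ |>.1 ((hd'.relMap_part_iff (Sum.inl i)).1
      ((isPart_inl M N).part_apply (a i)))
  have hr : ∀ i, ∃ b' : N', (e.symm ∘ d) (Sum.inr i) = Sum.inr b' := fun i =>
    (isPart_inr M' N').part_iff _ |>.1 ((hd'.relMap_part_iff (Sum.inr i)).1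
      ((isPart_inr M N).part_apply (b i)))
  choose a' ha' using hl
  choose b' hb' using hr
  obtain ⟨f, hf⟩ := ha M' a' ((isPart_inl M N).sameType (isPart_inl M' N') (by
    have := hd'.comp Sum.inl
    rwa [show (e.symm ∘ d) ∘ Sum.inl = Sum.inl ∘ a' from funext ha'] at this))
  obtain ⟨g, hg⟩ := hb N' b' ((isPart_inr M N).sameType (isPart_inr M' N') (by
    have := hd'.comp Sum.inr
    rwa [show (e.symm ∘ d) ∘ Sum.inr = Sum.inr ∘ b' from funext hb'] at this))
  refine ⟨e.toElementaryEmbedding.comp (f.sum g), ?_⟩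
  rintro (i | i)
  · change e (Sum.inl (f (a i))) = _
    rw [hf, ← ha']
    exact e.apply_symm_apply _
  · change e (Sum.inr (g (b i))) = _
    rw [hg, ← hb']
    exact e.apply_symm_apply _

variable {T₁ : L₁.Theory} {T₂ : L₂.Theory} {T : (disjointLanguage L₁ L₂).Theory}

/-- The disjoint union of models of two complete theories, as a model of the disjoint union of the
theories. -/
theorem exists_sum_countableModel (hT₁ : T₁.IsComplete) (hT₂ : T₂.IsComplete)
    (hT : IsDisjointUnion.{u₁, v₁, u₂, v₂, w₁, w₂} T T₁ T₂) (M : CountableModel T₁)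
    (N : CountableModel T₂) :
    ∃ K : CountableModel T, Nonempty ((M.1 ⊕ N.1) ≃[disjointLanguage L₁ L₂] K.1) := by
  obtain ⟨M₁, M₂, rfl⟩ := hT
  have h := (hT₁.elementarilyEquivalent M₁ M.1).sum (hT₂.elementarilyEquivalent M₂ N.1)
  have : (M.1 ⊕ N.1) ⊨ (disjointLanguage L₁ L₂).completeTheory (M₁ ⊕ M₂) :=
    (ElementarilyEquivalent.theory_model_iff h).1 inferInstance
  exact exists_countableModel_equiv _

/-- Every model of the disjoint union of two theories is a disjoint union of models of these
theories. -/
theorem exists_equiv_sum_countableModel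
    (hT : IsDisjointUnion.{u₁, v₁, u₂, v₂, w₁, w₂} T T₁ T₂) (K : CountableModel T) :
    ∃ (M : CountableModel T₁) (N : CountableModel T₂),
      Nonempty ((M.1 ⊕ N.1) ≃[disjointLanguage L₁ L₂] K.1) := by
  obtain ⟨M₁, M₂, rfl⟩ := hT
  have hK : (M₁ ⊕ M₂) ≅[disjointLanguage L₁ L₂] K.1 :=
    (completeTheory.isComplete (disjointLanguage L₁ L₂) (M₁ ⊕ M₂)).elementarilyEquivalent _ _
  obtain ⟨M, N, _, _, h₁, h₂, ⟨e⟩⟩ := exists_sum_equiv hK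
  have : M ⊨ T₁ := h₁.theory_model_iff.1 inferInstance
  have : N ⊨ T₂ := h₂.theory_model_iff.1 inferInstance
  have : Nonempty M := h₁.nonempty_iff.1 inferInstance
  have : Nonempty N := h₂.nonempty_iff.1 inferInstance
  exact ⟨⟨Theory.ModelType.of T₁ M, (e.toEquiv.injective.comp Sum.inl_injective).countable⟩,
    ⟨Theory.ModelType.of T₂ N, (e.toEquiv.injective.comp Sum.inr_injective).countable⟩, ⟨e⟩⟩

/-- The preorder of a disjoint union of complete theories is the product of the preorders of these
theories. -/
theorem nonempty_LRK_orderIso_prod (hT₁ : T₁.IsComplete) (hT₂ : T₂.IsComplete)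
    (hT : IsDisjointUnion.{u₁, v₁, u₂, v₂, w₁, w₂} T T₁ T₂) :
    Nonempty (LRK T ≃o LRK T₁ × LRK T₂) := by
  choose S e using exists_sum_countableModel hT₁ hT₂ hT
  have e := fun M N => (e M N).some
  let G : LRK T₁ × LRK T₂ → LRK T := fun p => LRK.mk (S p.1.rep p.2.rep)
    ((p.1.isPrimeOverFinite_rep.sum p.2.isPrimeOverFinite_rep).of_equiv (e _ _))
  -- The value of `G` at a pair is the type of the disjoint union of the two models.
  have r : ∀ p, Nonempty ((G p).rep.1 ≃[disjointLanguage L₁ L₂] (p.1.rep.1 ⊕ p.2.rep.1)) :=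
    fun p => (LRK.eq_mk_iff.1 (show G p = LRK.mk _ _ from rfl)).map fun f => (e _ _).symm.comp f
  have r := fun p => (r p).some
  have hle : ∀ p q, G p ≤ G q ↔ p ≤ q := by
    intro p q
    rw [LRK.le_iff, Prod.le_def, LRK.le_iff, LRK.le_iff]
    constructor
    · rintro ⟨f⟩
      let f' := (r q).toElementaryEmbedding.comp (f.comp (r p).symm.toElementaryEmbedding)
      obtain ⟨g, -⟩ := (isPart_inl _ _).exists_elementaryEmbedding (isPart_inl _ _) f'
      obtain ⟨g', -⟩ := (isPart_inr _ _).exists_elementaryEmbedding (isPart_inr _ _) f'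
      exact ⟨⟨g⟩, ⟨g'⟩⟩
    · rintro ⟨⟨g⟩, ⟨g'⟩⟩
      exact ⟨(r q).symm.toElementaryEmbedding.comp
        ((g.sum g').comp (r p).toElementaryEmbedding)⟩
  have hinj : Function.Injective G := by
    intro p q h
    obtain ⟨f⟩ := LRK.eq_iff.1 h
    let f' := (r q).comp (f.comp (r p).symm)
    exact Prod.ext (LRK.eq_iff.2 ((isPart_inl _ _).nonempty_equiv (isPart_inl _ _) f'))
      (LRK.eq_iff.2 ((isPart_inr _ _).nonempty_equiv (isPart_inr _ _) f'))
  have hsurj : Function.Surjective G := by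
    intro c
    obtain ⟨M, N, ⟨f⟩⟩ := exists_equiv_sum_countableModel hT c.rep
    obtain ⟨hM, hN⟩ := (c.isPrimeOverFinite_rep.of_equiv f.symm).of_sum
    refine ⟨(LRK.mk M hM, LRK.mk N hN), (LRK.eq_iff.2 ?_)⟩
    obtain ⟨g⟩ := LRK.eq_mk_iff.1 (show LRK.mk M hM = LRK.mk M hM from rfl)
    obtain ⟨g'⟩ := LRK.eq_mk_iff.1 (show LRK.mk N hN = LRK.mk N hN from rfl)
    let s := (g.toElementaryEmbedding.sum g'.toElementaryEmbedding).equivOfSurjective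
      (g.toEquiv.surjective.sumMap g'.toEquiv.surjective)
    exact ⟨f.comp (s.comp (r _))⟩
  exact ⟨(⟨_root_.Equiv.ofBijective G ⟨hinj, hsurj⟩, hle _ _⟩ : LRK T₁ × LRK T₂ ≃o LRK T).symm⟩

end SumPrime

end FirstOrder.Language

theorem mainTheorem2
    (L₁ : FirstOrder.Language.{u₁, v₁}) (L₂ : FirstOrder.Language.{u₂, v₂})
    [Countable L₁.Symbols] [Countable L₂.Symbols]
    (T₁ : L₁.Theory) (T₂ : L₂.Theory)
    (hT₁ : T₁.IsComplete) (hT₂ : T₂.IsComplete)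
    (hI₁ : FirstOrder.Language.numCountableModels T₁ < ⊤) (hI₂ : FirstOrder.Language.numCountableModels T₂ < ⊤)
    (T : (FirstOrder.Language.disjointLanguage L₁ L₂).Theory)
    (hT : FirstOrder.Language.IsDisjointUnion.{u₁, v₁, u₂, v₂, w₁, w₂} T T₁ T₂) :
    (FirstOrder.Language.IsLatticeOrdered (FirstOrder.Language.LRK T) ↔
      FirstOrder.Language.IsLatticeOrdered (FirstOrder.Language.LRK T₁) ∧
        FirstOrder.Language.IsLatticeOrdered (FirstOrder.Language.LRK T₂)) ∧
    (FirstOrder.Language.IsBooleanOrdered (FirstOrder.Language.LRK T) ↔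
      FirstOrder.Language.IsBooleanOrdered (FirstOrder.Language.LRK T₁) ∧
        FirstOrder.Language.IsBooleanOrdered (FirstOrder.Language.LRK T₂)) ∧
    (FirstOrder.Language.IsLinearlyOrdered (FirstOrder.Language.LRK T) ↔
      FirstOrder.Language.IsLinearlyOrdered (FirstOrder.Language.LRK T₁) ∧
        FirstOrder.Language.IsLinearlyOrdered (FirstOrder.Language.LRK T₂) ∧
        min (FirstOrder.Language.numCountableModels T₁) (FirstOrder.Language.numCountableModels T₂) = 1) := by
  have f₁ := ENat.card_lt_top.1 hI₁
  have f₂ := ENat.card_lt_top.1 hI₂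
  have n₁ := FirstOrder.Language.nonempty_LRK hT₁.1
  have n₂ := FirstOrder.Language.nonempty_LRK hT₂.1
  obtain ⟨e⟩ := FirstOrder.Language.nonempty_LRK_orderIso_prod hT₁ hT₂ hT
  refine ⟨FirstOrder.Language.isLatticeOrdered_iff_of_orderIso_prod e,
    FirstOrder.Language.isBooleanOrdered_iff_of_orderIso_prod e,
    (FirstOrder.Language.isLinearlyOrdered_iff_of_orderIso_prod e).trans
      (and_congr_right fun _ => and_congr_right fun _ => ?_)⟩
  rw [← FirstOrder.Language.numCountableModels_eq_one_iff hT₁,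
    ← FirstOrder.Language.numCountableModels_eq_one_iff hT₂]
  have p₁ : 1 ≤ FirstOrder.Language.numCountableModels T₁ :=
    (ENat.one_le_card_iff_nonempty _).2 (n₁.map Subtype.val)
  have p₂ : 1 ≤ FirstOrder.Language.numCountableModels T₂ :=
    (ENat.one_le_card_iff_nonempty _).2 (n₂.map Subtype.val)
  constructor
  · rintro (h | h) <;> rw [h]
    · exact min_eq_left p₂
    · exact min_eq_right p₁
  · intro h
    rcases min_choice (FirstOrder.Language.numCountableModels T₁)
      (FirstOrder.Language.numCountableModels T₂) with h' | h'
    · exact Or.inl (h'.symm.trans h)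
    · exact Or.inr (h'.symm.trans h)
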